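/- For a graph $G$ with graph distance $d$ and $t, r \in \mathbb{N}$, a set $\mathcal{T}$ of vertices (towers) is called $(t,r)$ broadcast dominating if every vertex $v$ of $G$ satisfies $\sum_{u \in \mathcal{T}} \max\{0,\, t - d(u,v)\} \ge r$. The density of a set $\mathcal{T} \subseteq \mathbb{Z}^2$ is $\limsup_{n \to \infty} \frac{|\mathcal{T} \cap [-n,n]^2|}{(2n+1)^2}$. Let $\delta_{t,r}(\mathbb{Z}^2)$ denote the minimal density of a $(t,r)$ broadcast dominating set in the infinite grid $\mathbb{Z}^2$, in which two vertices are adjacent when they differ by $1$ in exactly one coordinate and agree in the other. Theorem. For every integer $t > 17$, both of the minimal densities $\delta_{t,3}(\mathbb{Z}^2)$ and $\delta_{t-1,1}(\mathbb{Z}^2)$ are attained, and $$\delta_{t,3}(\mathbb{Z}^2) = \delta_{t-1,1}(\mathbb{Z}^2).$$ -/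

import Mathlib

open Filter
open scoped ENNReal

noncomputable section

namespace Broadcast

/-- The signal `max {0, t - d(u, v)}` which a tower of strength `t` at the vertex `u` transmits
to the vertex `v`, where `d` is the graph distance (`⊤` between different components, where the
truncated difference is `0`). -/
def signal {V : Type*} (G : SimpleGraph V) (t : ℕ) (u v : V) : ℝ≥0∞ :=
  (t : ℝ≥0∞) - ((G.edist u v : ℕ∞) : ℝ≥0∞)

/-- A set `T` of vertices (towers) is `(t, r)` broadcast dominating if every vertex receives a
total signal of at least `r` from the towers in `T`, each of which has strength `t`. -/
def IsDominating {V : Type*} (G : SimpleGraph V) (t r : ℕ) (T : Set V) : Prop :=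
  ∀ v : V, (r : ℝ≥0∞) ≤ ∑' u : T, signal G t (u : V) v

/-- The infinite grid on `ℤ × ℤ`: the Cartesian product of two two-way infinite paths. -/
def grid : SimpleGraph (ℤ × ℤ) :=
  (SimpleGraph.hasse ℤ).boxProd (SimpleGraph.hasse ℤ)

/-- The box `[-n, n]²` in `ℤ × ℤ`. -/
def box (n : ℕ) : Set (ℤ × ℤ) :=
  Set.Icc (-(n : ℤ)) (n : ℤ) ×ˢ Set.Icc (-(n : ℤ)) (n : ℤ)

/-- The (upper) density `limsup |T ∩ [-n, n]²| / (2n + 1)²` of a set `T ⊆ ℤ × ℤ`. The sequence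
takes values in `[0, 1]`. -/
def density (T : Set (ℤ × ℤ)) : ℝ :=
  limsup (fun n : ℕ => ((T ∩ box n).ncard : ℝ) / (2 * (n : ℝ) + 1) ^ 2) atTop

/-- The set of the densities of all `(t, r)` broadcast dominating sets in the infinite grid. -/
def densities (t r : ℕ) : Set ℝ :=
  {x | ∃ T : Set (ℤ × ℤ), IsDominating grid t r T ∧ density T = x}

/-- The minimal density of a `(t, r)` broadcast dominating set in the infinite grid. -/
def minDensity (t r : ℕ) : ℝ :=
  sInf (densities t r)

end Broadcast

end

noncomputable section

namespace Broadcast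

/-! Put R = t - 2 and N = 2R² + 2R + 1, the size of a ball of radius R. Both minima equal 1/N. A
(t-1,1) dominating set is a covering by balls of radius R, so its density is at least 1/N, with
equality for the lattice `perfectTowers`; and every such covering is (t,3) dominating
(`isDominating_three_of_one`). The real content is the lower bound 1/N for (t,3).

Truncate every signal at 3; each vertex still receives at least 3. A tower emits at most |B(R-1)| +
|B(R)| + |B(R+1)| = 3N + 4, so it suffices that the excess over 3 is on average at least 4 per tower
(`four_mul_card_le_sum_excess`).

The sum over the two horizontal neighbours minus that over the two vertical ones, applied to a
truncated signal, vanishes except at the tips of the ball, where it has weights 1, 2, 2, 1: positive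
at horizontal tips, negative at vertical ones (`capped_diff`). As excess is nonnegative, a
horizontal tip forces excess 2 in its own row, even when vertical tips cross it or another
horizontal tip overlaps it (`two_mul_card_le_sum_windows`). Two tips per tower give 4. This may fail
only because of crowded towers, those within distance 13 of another; each spoils at most 8 tips
(`card_bad_le`) but pays 16 by the excess close to it (`sixteen_mul_card_crowded_le`), on cells that
good tips do not use. -/

/-! ### Excess forced along one row by one or two tips -/

/-- The contribution of the end of a ball to the mixed second difference of the capped signal. -/
def tipWeight (i : ℤ) : ℤ :=
  if i = 0 ∨ i = 3 then 1 else if i = 1 ∨ i = 2 then 2 else 0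

theorem tipWeight_nonneg (i : ℤ) : 0 ≤ tipWeight i := by
  unfold tipWeight; split_ifs <;> norm_num

theorem tipWeight_le_two (i : ℤ) : tipWeight i ≤ 2 := by
  unfold tipWeight; split_ifs <;> norm_num

theorem mem_range_of_tipWeight_ne_zero {i : ℤ} (h : tipWeight i ≠ 0) : 0 ≤ i ∧ i ≤ 3 := by
  unfold tipWeight at h
  split_ifs at h <;> omega

/-- Here `g` is the excess on six cells, and `c`, `c'` are the columns where an upper and a lower
vertical tip may cross. If a middle index is not hit, its inequality alone gives 2; if both are hit,
the outer two are intact and give 1 + 1 on disjoint pairs of cells. -/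
theorem row_sum_single (g : ℕ → ℤ) (hg : ∀ i < 6, 0 ≤ g i) (c c' : ℤ)
    (H : ∀ i : ℕ, i ≤ 3 → tipWeight i - (if (i : ℤ) = c then 2 else 0) -
      (if (i : ℤ) = c' then 2 else 0) ≤ g i + g (i + 2)) :
    2 ≤ ∑ i ∈ Finset.range 6, g i := by
  have a0 := H 0 (by norm_num)
  have a1 := H 1 (by norm_num)
  have a2 := H 2 (by norm_num)
  have a3 := H 3 (by norm_num)
  have b0 := hg 0 (by norm_num)
  have b1 := hg 1 (by norm_num)
  have b2 := hg 2 (by norm_num)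
  have b3 := hg 3 (by norm_num)
  have b4 := hg 4 (by norm_num)
  have b5 := hg 5 (by norm_num)
  simp only [tipWeight] at a0 a1 a2 a3
  norm_num at a0 a1 a2 a3
  simp only [Finset.sum_range_succ, Finset.sum_range_zero]
  by_cases h1 : 1 = c ∨ 1 = c'
  · by_cases h2 : 2 = c ∨ 2 = c'
    · have : ¬ 0 = c ∧ ¬ 0 = c' ∧ ¬ 3 = c ∧ ¬ 3 = c' := by omega
      simp only [this, if_false] at a0 a3
      linarith
    · push Not at h2
      simp only [h2.1, h2.2, if_false] at a2
      linarith
  · push Not at h1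
    simp only [h1.1, h1.2, if_false] at a1
    linarith

/-- Six-cell windows at offset `d` overlap exactly when `d ≤ 5`; even then the two tips do not have
to share the excess. -/
theorem row_sum_pair (g : ℕ → ℤ) (d : ℕ) (hd : d ≤ 5) (hg : ∀ i < d + 6, 0 ≤ g i) (c c' : ℤ)
    (H : ∀ i : ℕ, i ≤ 3 ∨ d ≤ i ∧ i ≤ d + 3 →
      tipWeight i + tipWeight (i - d) - (if (i : ℤ) = c then 2 else 0) -
        (if (i : ℤ) = c' then 2 else 0) ≤ g i + g (i + 2)) :
    4 ≤ ∑ i ∈ Finset.range (d + 6), g i := by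
  -- Each crossing becomes a nonnegative function of mass at most 2 on the indices 0 to 8, so every
  -- value of `d` is a linear problem.
  have key : ∀ c : ℤ, ∃ x : ℕ → ℤ, (∀ i, 0 ≤ x i) ∧
      (∀ i : ℕ, (if (i : ℤ) = c then 2 else 0) = x i) ∧ ∑ i ∈ Finset.range 9, x i ≤ 2 := by
    intro c
    refine ⟨fun i => if (i : ℤ) = c then 2 else 0, fun i => by positivity, fun i => rfl, ?_⟩
    by_cases hc : ∃ k : ℕ, (k : ℤ) = c
    · obtain ⟨k, rfl⟩ := hc
      simp only [Nat.cast_inj, Finset.sum_ite_eq']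
      split_ifs <;> norm_num
    · push Not at hc
      simp [hc]
  obtain ⟨x, hx0, hx, hxs⟩ := key c
  obtain ⟨x', hx0', hx', hxs'⟩ := key c'
  simp only [hx, hx'] at H
  simp only [Finset.sum_range_succ, Finset.sum_range_zero] at hxs hxs'
  have y0 := hx0 0; have y1 := hx0 1; have y2 := hx0 2; have y3 := hx0 3; have y4 := hx0 4
  have y5 := hx0 5; have y6 := hx0 6; have y7 := hx0 7; have y8 := hx0 8
  have z0 := hx0' 0; have z1 := hx0' 1; have z2 := hx0' 2; have z3 := hx0' 3; have z4 := hx0' 4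
  have z5 := hx0' 5; have z6 := hx0' 6; have z7 := hx0' 7; have z8 := hx0' 8
  have b0 := hg 0 (by omega); have b1 := hg 1 (by omega); have b2 := hg 2 (by omega)
  have b3 := hg 3 (by omega); have b4 := hg 4 (by omega); have b5 := hg 5 (by omega)
  have a0 := H 0 (by omega); have a1 := H 1 (by omega); have a2 := H 2 (by omega)
  have a3 := H 3 (by omega)
  clear hx hx' hx0 hx0' key
  interval_cases d <;> simp only [Finset.sum_range_succ, Finset.sum_range_zero]
  · simp [tipWeight] at a0 a1 a2 a3
    linarith
  · have a4 := H 4 (by omega); have b6 := hg 6 (by omega)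
    simp [tipWeight] at a0 a1 a2 a3 a4
    linarith
  · have a4 := H 4 (by omega); have b6 := hg 6 (by omega)
    have a5 := H 5 (by omega); have b7 := hg 7 (by omega)
    simp [tipWeight] at a0 a1 a2 a3 a4 a5
    linarith
  · have a4 := H 4 (by omega); have b6 := hg 6 (by omega)
    have a5 := H 5 (by omega); have b7 := hg 7 (by omega)
    have a6 := H 6 (by omega); have b8 := hg 8 (by omega)
    simp [tipWeight] at a0 a1 a2 a3 a4 a5 a6
    linarith
  · have a4 := H 4 (by omega); have b6 := hg 6 (by omega)
    have a5 := H 5 (by omega); have b7 := hg 7 (by omega)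
    have a6 := H 6 (by omega); have b8 := hg 8 (by omega)
    have a7 := H 7 (by omega); have b9 := hg 9 (by omega)
    simp [tipWeight] at a0 a1 a2 a3 a4 a5 a6 a7
    linarith
  · have b6 := hg 6 (by omega)
    have a5 := H 5 (by omega); have b7 := hg 7 (by omega)
    have a6 := H 6 (by omega); have b8 := hg 8 (by omega)
    have a7 := H 7 (by omega); have b9 := hg 9 (by omega)
    have a8 := H 8 (by omega); have b10 := hg 10 (by omega)
    simp [tipWeight] at a0 a1 a2 a3 a5 a6 a7 a8
    linarith

/-! ### Truncated signals and their mixed second difference -/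

/-- The signal of a tower of strength `R + 2` at distance `k`, truncated at `3`. -/
def capped (R k : ℤ) : ℤ := max 0 (min 3 (R + 2 - k))

/-- The graph distance in the grid, as an integer. -/
def l1 (u v : ℤ × ℤ) : ℤ := |u.1 - v.1| + |u.2 - v.2|

/-- The sum of the truncated signals of the towers in `F`. -/
def cappedSum (R : ℤ) (F : Finset (ℤ × ℤ)) (v : ℤ × ℤ) : ℤ := ∑ P ∈ F, capped R (l1 v P)

/-- The left (or lower) end of the four cells around a tip of the ball of radius `R` about `x`. -/
def tip (R x : ℤ) (b : Bool) : ℤ := if b then x + R - 1 else x - R - 2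

/-- The horizontal tips of the tower `P`. -/
def horizontal (R : ℤ) (P : ℤ × ℤ) (b : Bool) (z : ℤ × ℤ) : ℤ :=
  if z.2 = P.2 then tipWeight (z.1 - tip R P.1 b) else 0

/-- The vertical tips of the tower `P`. -/
def vertical (R : ℤ) (P : ℤ × ℤ) (b : Bool) (z : ℤ × ℤ) : ℤ :=
  if z.1 = P.1 then tipWeight (z.2 - tip R P.2 b) else 0

theorem horizontal_nonneg (R : ℤ) (P : ℤ × ℤ) (b : Bool) (z : ℤ × ℤ) : 0 ≤ horizontal R P b z := by
  unfold horizontal; split_ifs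
  exacts [tipWeight_nonneg _, le_rfl]

theorem vertical_le_two (R : ℤ) (P : ℤ × ℤ) (b : Bool) (z : ℤ × ℤ) : vertical R P b z ≤ 2 := by
  unfold vertical; split_ifs
  exacts [tipWeight_le_two _, by norm_num]

theorem tipWeight_three_sub (i : ℤ) : tipWeight (3 - i) = tipWeight i := by
  unfold tipWeight; split_ifs <;> first | rfl | omega

theorem capped_sub_capped (R k : ℤ) :
    capped R (k - 1) - capped R (k + 1) = tipWeight (k - (R - 1)) := by
  unfold capped tipWeight; split_ifs <;> omega

theorem tipWeight_eq_zero {i : ℤ} (h : i < 0 ∨ 3 < i) : tipWeight i = 0 := by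
  by_contra h'
  have := mem_range_of_tipWeight_ne_zero h'
  omega

theorem capped_axis {R : ℤ} (hR : 2 ≤ R) (a : ℤ) :
    capped R (|a + 1| + 0) + capped R (|a - 1| + 0) - capped R (|a| + 1) - capped R (|a| + 1) =
      tipWeight (a - (R - 1)) + tipWeight (a - (-R - 2)) := by
  rcases lt_trichotomy a 0 with h | rfl | h
  · rw [abs_of_neg h, abs_of_nonpos (by omega : a + 1 ≤ 0), abs_of_neg (by omega : a - 1 < 0),
      tipWeight_eq_zero (i := a - (R - 1)) (by omega), ← tipWeight_three_sub,
      show 3 - (a - (-R - 2)) = -a - (R - 1) by ring, ← capped_sub_capped,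
      show -(a + 1) + 0 = -a - 1 by ring, show -(a - 1) + 0 = -a + 1 by ring]
    ring
  · rw [tipWeight_eq_zero (by omega), tipWeight_eq_zero (by omega)]
    norm_num
  · rw [abs_of_pos h, abs_of_pos (by omega : 0 < a + 1), abs_of_nonneg (by omega : 0 ≤ a - 1),
      tipWeight_eq_zero (i := a - (-R - 2)) (by omega), ← capped_sub_capped, add_zero, add_zero]
    ring

/-- Off the axes through `P` the horizontal and the vertical neighbours have the same two distances
and cancel. On an axis both transverse neighbours are one step farther, which leaves `capped R (k -
1) - capped R (k + 1)` up to sign. At the centre all four distances agree, and `2 ≤ R` keeps the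
tips away from it. -/
theorem capped_diff {R : ℤ} (hR : 2 ≤ R) (P : ℤ × ℤ) (x y : ℤ) :
    capped R (l1 (x + 1, y) P) + capped R (l1 (x - 1, y) P) - capped R (l1 (x, y + 1) P) -
        capped R (l1 (x, y - 1) P) =
      horizontal R P true (x, y) + horizontal R P false (x, y) - vertical R P true (x, y) -
        vertical R P false (x, y) := by
  obtain ⟨p, q⟩ := P
  simp only [l1, horizontal, vertical, tip]
  obtain ⟨a, rfl⟩ : ∃ a, x = p + a := ⟨x - p, by ring⟩
  obtain ⟨b, rfl⟩ : ∃ b, y = q + b := ⟨y - q, by ring⟩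
  have e1 : p + a + 1 - p = a + 1 := by ring
  have e2 : p + a - 1 - p = a - 1 := by ring
  have e3 : q + b + 1 - q = b + 1 := by ring
  have e4 : q + b - 1 - q = b - 1 := by ring
  have e5 : p + a - p = a := by ring
  have e6 : q + b - q = b := by ring
  have e7 : p + a - (p + R - 1) = a - (R - 1) := by ring
  have e8 : p + a - (p - R - 2) = a - (-R - 2) := by ring
  have e9 : q + b - (q + R - 1) = b - (R - 1) := by ring
  have e10 : q + b - (q - R - 2) = b - (-R - 2) := by ring
  simp only [e1, e2, e3, e4, e5, e6, e7, e8, e9, e10, if_true, Bool.false_eq_true, if_false,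
    add_eq_left]
  have ha := capped_axis hR a
  have hb := capped_axis hR b
  by_cases h1 : a = 0
  · by_cases h2 : b = 0
    · subst h1 h2
      simp only [if_true]
      norm_num
    · subst h1
      simp only [h2, if_true, if_false]
      simp only [zero_add, zero_sub, abs_neg, abs_one, abs_zero, add_zero] at hb ⊢
      rw [add_comm 1 |b|]
      linarith
  · by_cases h2 : b = 0
    · subst h2
      simp only [h1, if_true, if_false]
      simp only [zero_add, zero_sub, abs_neg, abs_one, abs_zero, add_zero] at ha ⊢
      linarith
    · simp only [h1, h2, if_false]
      rcases lt_or_gt_of_ne h1 with h1 | h1 <;> rcases lt_or_gt_of_ne h2 with h2 | h2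
      · rw [abs_of_neg h1, abs_of_neg h2, abs_of_nonpos (by omega : a + 1 ≤ 0),
          abs_of_nonpos (by omega : b + 1 ≤ 0), abs_of_neg (by omega : a - 1 < 0),
          abs_of_neg (by omega : b - 1 < 0)]
        ring_nf
      · rw [abs_of_neg h1, abs_of_pos h2, abs_of_nonpos (by omega : a + 1 ≤ 0),
          abs_of_pos (by omega : 0 < b + 1), abs_of_neg (by omega : a - 1 < 0),
          abs_of_nonneg (by omega : 0 ≤ b - 1)]
        ring_nf
      · rw [abs_of_pos h1, abs_of_neg h2, abs_of_pos (by omega : 0 < a + 1),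
          abs_of_nonpos (by omega : b + 1 ≤ 0), abs_of_nonneg (by omega : 0 ≤ a - 1),
          abs_of_neg (by omega : b - 1 < 0)]
        ring_nf
      · rw [abs_of_pos h1, abs_of_pos h2, abs_of_pos (by omega : 0 < a + 1),
          abs_of_pos (by omega : 0 < b + 1), abs_of_nonneg (by omega : 0 ≤ a - 1),
          abs_of_nonneg (by omega : 0 ≤ b - 1)]
        ring_nf

theorem cappedSum_diff {R : ℤ} (hR : 2 ≤ R) (F : Finset (ℤ × ℤ)) (x y : ℤ) :
    cappedSum R F (x + 1, y) + cappedSum R F (x - 1, y) - cappedSum R F (x, y + 1) -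
        cappedSum R F (x, y - 1) =
      ∑ P ∈ F, (horizontal R P true (x, y) + horizontal R P false (x, y)) -
        ∑ P ∈ F, vertical R P true (x, y) - ∑ P ∈ F, vertical R P false (x, y) := by
  simp only [cappedSum, ← Finset.sum_add_distrib, ← Finset.sum_sub_distrib, capped_diff hR]

/-! ### Crowded towers and the excess in the window of a good tip -/

/-- The towers which have another tower within distance `13`. -/
def crowded (F : Finset (ℤ × ℤ)) : Finset (ℤ × ℤ) := by
  classical exact F.filter fun Q => ∃ Q' ∈ F, Q' ≠ Q ∧ l1 Q' Q ≤ 13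

theorem mem_crowded {F : Finset (ℤ × ℤ)} {Q : ℤ × ℤ} :
    Q ∈ crowded F ↔ Q ∈ F ∧ ∃ Q' ∈ F, Q' ≠ Q ∧ l1 Q' Q ≤ 13 := by
  classical
  unfold crowded
  rw [Finset.mem_filter]

theorem eq_of_not_crowded {F : Finset (ℤ × ℤ)} {P P' : ℤ × ℤ} (hP : P ∈ F) (hc : P ∉ crowded F)
    (hP' : P' ∈ F) (h : |P'.1 - P.1| + |P'.2 - P.2| ≤ 13) : P' = P := by
  by_contra hne
  exact hc (mem_crowded.2 ⟨hP, P', hP', hne, h⟩)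

/-- The left end of the four cells around a horizontal tip. -/
def left (R : ℤ) (s : (ℤ × ℤ) × Bool) : ℤ := tip R s.1.1 s.2

/-- A horizontal tip of an uncrowded tower which is undisturbed by crowded towers. -/
def IsGood (R : ℤ) (F : Finset (ℤ × ℤ)) (s : (ℤ × ℤ) × Bool) : Prop :=
  s.1 ∈ F ∧ s.1 ∉ crowded F ∧
    (∀ Q ∈ crowded F, ∀ b, ∀ i, 0 ≤ i → i ≤ 3 → vertical R Q b (left R s + i, s.1.2) = 0) ∧
    ∀ Q ∈ crowded F, ∀ i, -1 ≤ i → i ≤ 4 → 2 < l1 (left R s + i, s.1.2) Q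

theorem eq_row_of_vertical_ne_zero {R : ℤ} {P : ℤ × ℤ} {b : Bool} {z : ℤ × ℤ}
    (h : vertical R P b z ≠ 0) : z.1 = P.1 ∧ 0 ≤ z.2 - tip R P.2 b ∧ z.2 - tip R P.2 b ≤ 3 := by
  unfold vertical at h
  split_ifs at h with h1
  · exact ⟨h1, mem_range_of_tipWeight_ne_zero h⟩
  · exact absurd rfl h

/-- Two towers whose tips in direction `b` meet row `y` in columns of `X` differ by at most 8
horizontally and 3 vertically. Since 8 + 3 ≤ 13 and neither is crowded, they coincide. -/
theorem exists_vertical_sum_le (R : ℤ) (F : Finset (ℤ × ℤ)) (y : ℤ) (b : Bool) (X : Set ℤ)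
    (hX : ∀ x ∈ X, ∀ Q ∈ crowded F, vertical R Q b (x, y) = 0)
    (hd : ∀ x ∈ X, ∀ x' ∈ X, |x - x'| ≤ 8) :
    ∃ c : ℤ, ∀ x ∈ X, ∑ P ∈ F, vertical R P b (x, y) ≤ if x = c then 2 else 0 := by
  by_cases h : ∃ x ∈ X, ∃ P ∈ F, vertical R P b (x, y) ≠ 0
  · obtain ⟨x, hx, P, hP, hv⟩ := h
    have hPc : P ∉ crowded F := fun hc => hv (hX x hx P hc)
    have huniq : ∀ x' ∈ X, ∀ P' ∈ F, vertical R P' b (x', y) ≠ 0 → P' = P := by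
      intro x' hx' P' hP' hv'
      apply eq_of_not_crowded hP hPc hP'
      have h1 := eq_row_of_vertical_ne_zero hv
      have h2 := eq_row_of_vertical_ne_zero hv'
      have h3 := hd x hx x' hx'
      simp only [tip] at h1 h2
      rw [abs_le] at h3
      have h4 : |P'.1 - P.1| ≤ 8 := by rw [abs_le]; omega
      have h5 : |P'.2 - P.2| ≤ 3 := by rw [abs_le]; cases b <;> simp at h1 h2 <;> omega
      linarith
    refine ⟨x, fun x' hx' => ?_⟩
    split_ifs with hxx
    · rw [Finset.sum_eq_single_of_mem P hP]
      · exact vertical_le_two _ _ _ _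
      · intro P' hP' hne
        by_contra h0
        exact hne (huniq x' hx' P' hP' h0)
    · refine (Finset.sum_eq_zero fun P' hP' => ?_).le
      by_contra h0
      have h1 := huniq x' hx' P' hP' h0
      subst h1
      exact hxx ((eq_row_of_vertical_ne_zero h0).1.trans (eq_row_of_vertical_ne_zero hv).1.symm)
  · push Not at h
    refine ⟨0, fun x hx => ?_⟩
    rw [Finset.sum_eq_zero fun P hP => h x hx P hP]
    split_ifs <;> norm_num

theorem horizontal_left (R : ℤ) (s : (ℤ × ℤ) × Bool) (x : ℤ) :
    horizontal R s.1 s.2 (x, s.1.2) = tipWeight (x - left R s) := by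
  simp [horizontal, left]

theorem horizontal_le_pair (R : ℤ) (P : ℤ × ℤ) (b : Bool) (z : ℤ × ℤ) :
    horizontal R P b z ≤ horizontal R P true z + horizontal R P false z := by
  have h1 := horizontal_nonneg R P true z
  have h2 := horizontal_nonneg R P false z
  cases b <;> linarith

/-- The constant 3 cancels in `cappedSum_diff`; dropping the nonnegative excess of the rows above
and below leaves the hypotheses of `row_sum_single`. -/
theorem window_sum_single {R : ℤ} (hR : 2 ≤ R) {F : Finset (ℤ × ℤ)} {s : (ℤ × ℤ) × Bool}
    (hs : IsGood R F s)
    (hpos : ∀ x y, left R s - 1 ≤ x → x ≤ left R s + 4 → |y - s.1.2| ≤ 1 →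
      3 ≤ cappedSum R F (x, y)) :
    2 ≤ ∑ i ∈ Finset.range 6, (cappedSum R F (left R s - 1 + (i : ℕ), s.1.2) - 3) := by
  obtain ⟨hF, hc, hcross, -⟩ := hs
  have hX : ∀ b, ∃ c : ℤ, ∀ x ∈ Set.Icc (left R s) (left R s + 3),
      ∑ P ∈ F, vertical R P b (x, s.1.2) ≤ if x = c then 2 else 0 := by
    intro b
    apply exists_vertical_sum_le
    · intro x hx Q hQ
      have := hcross Q hQ b (x - left R s) (by linarith [hx.1]) (by linarith [hx.2])
      rwa [add_sub_cancel] at this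
    · rintro x ⟨hx, hx1⟩ x' ⟨hx', hx1'⟩
      rw [abs_le]; omega
  obtain ⟨c, hc1⟩ := hX true
  obtain ⟨c', hc2⟩ := hX false
  apply row_sum_single _ _ (c - left R s) (c' - left R s)
  · intro i hi
    have hi' : |((i : ℕ) : ℤ) - 3| ≤ 3 := by rw [abs_le]; omega
    have e1 := hpos (left R s + i) (s.1.2 + 1) (by omega) (by omega) (by norm_num)
    have e2 := hpos (left R s + i) (s.1.2 - 1) (by omega) (by omega) (by norm_num)
    have e3 := cappedSum_diff hR F (left R s + i) s.1.2
    have e4 := hc1 (left R s + i) ⟨by omega, by omega⟩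
    have e5 := hc2 (left R s + i) ⟨by omega, by omega⟩
    have e6 : tipWeight i ≤ ∑ P ∈ F, (horizontal R P true (left R s + i, s.1.2) +
        horizontal R P false (left R s + i, s.1.2)) := by
      have := horizontal_left R s (left R s + i)
      rw [add_sub_cancel_left] at this
      rw [← this]
      refine (horizontal_le_pair R s.1 s.2 _).trans ?_
      exact Finset.single_le_sum (f := fun P => horizontal R P true (left R s + i, s.1.2) +
        horizontal R P false (left R s + i, s.1.2))
        (fun P _ => add_nonneg (horizontal_nonneg _ _ _ _) (horizontal_nonneg _ _ _ _)) hF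
    have e7 : left R s - 1 + ((i + 2 : ℕ) : ℤ) = left R s + i + 1 := by push_cast; ring
    have e8 : left R s - 1 + (i : ℤ) = left R s + i - 1 := by ring
    have e9 : ∀ c : ℤ, ((i : ℤ) = c - left R s) = (left R s + i = c) := fun c => by
      rw [eq_iff_iff]; constructor <;> intro h <;> omega
    simp only [e7, e8, e9]
    linarith
  · intro i hi
    have := hpos (left R s - 1 + i) s.1.2 (by omega) (by omega) (by norm_num)
    linarith

theorem window_sum_pair {R : ℤ} (hR : 2 ≤ R) {F : Finset (ℤ × ℤ)} {s s' : (ℤ × ℤ) × Bool}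
    (hs : IsGood R F s) (hs' : IsGood R F s') (hne : s.1 ≠ s'.1) (hy : s'.1.2 = s.1.2) (d : ℕ)
    (hd : d ≤ 5) (hl : left R s' = left R s + d)
    (hpos : ∀ x y, left R s - 1 ≤ x → x ≤ left R s + d + 4 → |y - s.1.2| ≤ 1 →
      3 ≤ cappedSum R F (x, y)) :
    4 ≤ ∑ i ∈ Finset.range (d + 6), (cappedSum R F (left R s - 1 + (i : ℕ), s.1.2) - 3) := by
  obtain ⟨hF, hc, hcross, -⟩ := hs
  obtain ⟨hF', hc', hcross', -⟩ := hs'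
  have hX : ∀ b, ∃ c : ℤ, ∀ x ∈ {x | left R s ≤ x ∧ x ≤ left R s + 3 ∨
        left R s + d ≤ x ∧ x ≤ left R s + d + 3},
      ∑ P ∈ F, vertical R P b (x, s.1.2) ≤ if x = c then 2 else 0 := by
    intro b
    apply exists_vertical_sum_le
    · rintro x (hx | hx) Q hQ
      · have := hcross Q hQ b (x - left R s) (by linarith [hx.1]) (by linarith [hx.2])
        rwa [add_sub_cancel] at this
      · have := hcross' Q hQ b (x - left R s') (by linarith [hx.1]) (by linarith [hx.2])
        rwa [add_sub_cancel, hy] at this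
    · intro x hx x' hx'
      simp only [Set.mem_ofPred_eq] at hx hx'
      rw [abs_le]; omega
  obtain ⟨c, hc1⟩ := hX true
  obtain ⟨c', hc2⟩ := hX false
  apply row_sum_pair _ d hd _ (c - left R s) (c' - left R s)
  · intro i hi
    have e1 := hpos (left R s + i) (s.1.2 + 1) (by omega) (by omega) (by norm_num)
    have e2 := hpos (left R s + i) (s.1.2 - 1) (by omega) (by omega) (by norm_num)
    have e3 := cappedSum_diff hR F (left R s + i) s.1.2
    have hmem : left R s + (i : ℤ) ∈ {x | left R s ≤ x ∧ x ≤ left R s + 3 ∨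
        left R s + d ≤ x ∧ x ≤ left R s + d + 3} := by
      simp only [Set.mem_ofPred_eq]; omega
    have e4 := hc1 (left R s + i) hmem
    have e5 := hc2 (left R s + i) hmem
    have e6 : tipWeight i + tipWeight (i - d) ≤
        ∑ P ∈ F, (horizontal R P true (left R s + i, s.1.2) +
        horizontal R P false (left R s + i, s.1.2)) := by
      have h1 := horizontal_left R s (left R s + i)
      rw [add_sub_cancel_left] at h1
      have h2 := horizontal_left R s' (left R s + i)
      rw [hy, hl, show left R s + (i : ℤ) - (left R s + d) = i - d by ring] at h2
      rw [← h1, ← h2]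
      refine (add_le_add (horizontal_le_pair R s.1 s.2 _) (horizontal_le_pair R s'.1 s'.2 _)).trans
        ?_
      rw [← Finset.sum_pair (f := fun P => horizontal R P true (left R s + i, s.1.2) +
        horizontal R P false (left R s + i, s.1.2)) hne]
      refine Finset.sum_le_sum_of_subset_of_nonneg ?_ fun P _ _ =>
        add_nonneg (horizontal_nonneg _ _ _ _) (horizontal_nonneg _ _ _ _)
      intro P hP
      simp only [Finset.mem_insert, Finset.mem_singleton] at hP
      rcases hP with rfl | rfl <;> assumption
    have e7 : left R s - 1 + ((i + 2 : ℕ) : ℤ) = left R s + i + 1 := by push_cast; ring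
    have e8 : left R s - 1 + (i : ℤ) = left R s + i - 1 := by ring
    have e9 : ∀ c : ℤ, ((i : ℤ) = c - left R s) = (left R s + i = c) := fun c => by
      rw [eq_iff_iff]; constructor <;> intro h <;> omega
    simp only [e7, e8, e9]
    linarith
  · intro i hi
    have := hpos (left R s - 1 + i) s.1.2 (by omega) (by omega) (by norm_num)
    linarith

/-! ### Sharing the excess between overlapping tips -/

/-- Two tips in the same row whose four cells lie within distance `5`. -/
def Near (R : ℤ) (s s' : (ℤ × ℤ) × Bool) : Prop := s.1.2 = s'.1.2 ∧ |left R s - left R s'| ≤ 5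

theorem eq_of_left_close {R : ℤ} {F : Finset (ℤ × ℤ)} {s s' : (ℤ × ℤ) × Bool} (hs : IsGood R F s)
    (hs' : IsGood R F s') (hb : s.2 = s'.2) (hy : |s.1.2 - s'.1.2| ≤ 3)
    (h : |left R s - left R s'| ≤ 10) : s = s' := by
  refine Prod.ext (eq_of_not_crowded hs'.1 hs'.2.1 hs.1 ?_) hb
  have : s.1.1 - s'.1.1 = left R s - left R s' := by
    simp only [left, tip, hb]; split_ifs <;> ring
  rw [this]
  linarith

/-- Among three tips two point the same way; these start within 10 of each other in one row, so they
coincide. Hence a class of near good tips has at most one left and one right tip. -/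
theorem Near.trans {R : ℤ} {F : Finset (ℤ × ℤ)} {s s' s'' : (ℤ × ℤ) × Bool} (hs : IsGood R F s)
    (hs' : IsGood R F s') (hs'' : IsGood R F s'') (h : Near R s s') (h' : Near R s' s'') :
    Near R s s'' := by
  obtain ⟨hy, hx⟩ := h
  obtain ⟨hy', hx'⟩ := h'
  by_cases h1 : s.2 = s'.2
  · rw [eq_of_left_close hs hs' h1 (by simp [hy]) (by linarith)]
    exact ⟨hy', hx'⟩
  · by_cases h2 : s'.2 = s''.2
    · rw [← eq_of_left_close hs' hs'' h2 (by simp [hy']) (by linarith)]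
      exact ⟨hy, hx⟩
    · have h3 : s.2 = s''.2 := by
        revert h1 h2
        cases s.2 <;> cases s'.2 <;> cases s''.2 <;> simp
      rw [eq_of_left_close hs hs'' h3 (by simp [hy, hy'])
        ((abs_sub_le _ (left R s') _).trans (by linarith))]
      exact ⟨rfl, by simp⟩

theorem Near.symm {R : ℤ} {s s' : (ℤ × ℤ) × Bool} (h : Near R s s') : Near R s' s :=
  ⟨h.1.symm, by rw [abs_sub_comm]; exact h.2⟩

/-- The six cells of its row on which a horizontal tip may draw. -/
def window (R : ℤ) (s : (ℤ × ℤ) × Bool) : Finset (ℤ × ℤ) :=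
  Finset.Icc (left R s - 1) (left R s + 4) ×ˢ Finset.Icc s.1.2 s.1.2

theorem mem_window {R : ℤ} {s : (ℤ × ℤ) × Bool} {v : ℤ × ℤ} :
    v ∈ window R s ↔ (left R s - 1 ≤ v.1 ∧ v.1 ≤ left R s + 4) ∧ v.2 = s.1.2 := by
  simp only [window, Finset.mem_product, Finset.mem_Icc]
  omega

theorem sum_range_le_sum_finset {f : ℤ × ℤ → ℤ} {U : Finset (ℤ × ℤ)} (hf : ∀ v ∈ U, 0 ≤ f v)
    (a y : ℤ) (k : ℕ) (h : ∀ i < k, (a + (i : ℕ), y) ∈ U) :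
    ∑ i ∈ Finset.range k, f (a + (i : ℕ), y) ≤ ∑ v ∈ U, f v := by
  have hinj : Function.Injective fun i : ℕ => ((a + (i : ℤ), y) : ℤ × ℤ) := by
    intro i j hij
    simp only [Prod.mk.injEq] at hij
    omega
  rw [show ∑ i ∈ Finset.range k, f (a + (i : ℕ), y) =
    ∑ v ∈ (Finset.range k).map ⟨_, hinj⟩, f v by rw [Finset.sum_map]; rfl]
  refine Finset.sum_le_sum_of_subset_of_nonneg ?_ fun v hv _ => hf v hv
  intro v hv
  simp only [Finset.mem_map, Finset.mem_range, Function.Embedding.coeFn_mk] at hv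
  obtain ⟨i, hi, rfl⟩ := hv
  exact h i hi

theorem near_of_mem_windows {R : ℤ} {s s' : (ℤ × ℤ) × Bool} {v : ℤ × ℤ} (h : v ∈ window R s)
    (h' : v ∈ window R s') : Near R s s' := by
  rw [mem_window] at h h'
  exact ⟨h.2.symm.trans h'.2, by rw [abs_le]; omega⟩

open Classical in
/-- The union of the windows of the tips in `G` near `s`. -/
def reach (R : ℤ) (G : Finset ((ℤ × ℤ) × Bool)) (s : (ℤ × ℤ) × Bool) : Finset (ℤ × ℤ) :=
  (G.filter (Near R s)).biUnion (window R)

theorem mem_reach {R : ℤ} {G : Finset ((ℤ × ℤ) × Bool)} {s : (ℤ × ℤ) × Bool} {v : ℤ × ℤ} :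
    v ∈ reach R G s ↔ ∃ s' ∈ G, Near R s s' ∧ v ∈ window R s' := by
  simp [reach, and_assoc]

open Classical in
/-- A tip near another one has to share. -/
def share (R : ℤ) (G : Finset ((ℤ × ℤ) × Bool)) (s : (ℤ × ℤ) × Bool) : ℤ :=
  if ∃ s' ∈ G, s' ≠ s ∧ Near R s s' then 1 else 2

theorem Near.refl (R : ℤ) (s : (ℤ × ℤ) × Bool) : Near R s s := ⟨rfl, by simp⟩

section

variable {R : ℤ} {F : Finset (ℤ × ℤ)} {G : Finset ((ℤ × ℤ) × Bool)}

theorem four_le_share_mul (hR : 3 ≤ R) (hG : ∀ s ∈ G, IsGood R F s)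
    (hpos : ∀ s ∈ G, ∀ x y, left R s - 1 ≤ x → x ≤ left R s + 4 → |y - s.1.2| ≤ 1 →
      3 ≤ cappedSum R F (x, y)) {s : (ℤ × ℤ) × Bool} (hs : s ∈ G) :
    4 ≤ share R G s * ∑ v ∈ reach R G s, (cappedSum R F v - 3) := by
  have hnn : ∀ v ∈ reach R G s, 0 ≤ cappedSum R F v - 3 := by
    intro v hv
    obtain ⟨s', hs', -, hv⟩ := mem_reach.1 hv
    rw [mem_window] at hv
    have := hpos s' hs' v.1 v.2 hv.1.1 hv.1.2 (by simp [hv.2])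
    simpa using this
  have hpair : ∀ s₁ ∈ G, ∀ s₂ ∈ G, Near R s s₁ → Near R s s₂ → s₁ ≠ s₂ →
      left R s₁ ≤ left R s₂ → 4 ≤ ∑ v ∈ reach R G s, (cappedSum R F v - 3) := by
    intro s₁ h₁ s₂ h₂ hn₁ hn₂ hne hle
    have hn := hn₁.symm.trans (hG _ h₁) (hG _ hs) (hG _ h₂) hn₂
    obtain ⟨hy, hx⟩ := hn
    have hb : s₁.2 ≠ s₂.2 := fun hb =>
      hne (eq_of_left_close (hG _ h₁) (hG _ h₂) hb (by simp [hy]) (by linarith))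
    rw [abs_le] at hx
    obtain ⟨d, hd⟩ := Int.eq_ofNat_of_zero_le (sub_nonneg.2 hle)
    refine (window_sum_pair (by omega) (hG _ h₁) (hG _ h₂) ?_ hy.symm d (by omega) (by omega)
      ?_).trans ?_
    -- Opposite tips of one tower start 2R + 1 apart, which exceeds 5 as `3 ≤ R`.
    · intro hP
      revert hd hx hle
      simp only [left, tip, hP]
      revert hb
      cases s₁.2 <;> cases s₂.2 <;> simp <;> omega
    · intro x y hx1 hx2 hy1
      by_cases hxx : x ≤ left R s₁ + 4
      · exact hpos s₁ h₁ x y hx1 hxx hy1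
      · exact hpos s₂ h₂ x y (by omega) (by omega) (by rw [← hy]; exact hy1)
    · apply sum_range_le_sum_finset hnn
      intro i hi
      rw [mem_reach]
      by_cases hi6 : i < 6
      · exact ⟨s₁, h₁, hn₁, mem_window.2 ⟨⟨by simp, by simp; omega⟩, rfl⟩⟩
      · exact ⟨s₂, h₂, hn₂, mem_window.2 ⟨⟨by simp; omega, by simp; omega⟩, hy⟩⟩
  unfold share
  split_ifs with h
  · obtain ⟨s', hs', hne, hn⟩ := h
    rw [one_mul]
    rcases le_total (left R s) (left R s') with hle | hle
    · exact hpair s hs s' hs' (Near.refl _ _) hn hne.symm hle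
    · exact hpair s' hs' s hs hn (Near.refl _ _) hne hle
  · have h2 := window_sum_single (by omega) (hG s hs) (hpos s hs)
    have h3 : ∑ i ∈ Finset.range 6, (cappedSum R F (left R s - 1 + (i : ℕ), s.1.2) - 3) ≤
        ∑ v ∈ reach R G s, (cappedSum R F v - 3) := by
      apply sum_range_le_sum_finset hnn
      intro i hi
      exact mem_reach.2 ⟨s, hs, Near.refl _ _, mem_window.2 ⟨⟨by simp, by simp; omega⟩, rfl⟩⟩
    linarith

open Classical in
-- By transitivity all tips whose reach contains `v` lie in one class: a single tip of share 2, or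
-- two tips of share 1.
theorem sum_share_le_two (hG : ∀ s ∈ G, IsGood R F s) (v : ℤ × ℤ) :
    ∑ s ∈ G.filter (fun s => v ∈ reach R G s), share R G s ≤ 2 := by
  by_cases h : ∃ s ∈ G, v ∈ reach R G s
  · obtain ⟨s, hs, hv⟩ := h
    have hsub : G.filter (fun s => v ∈ reach R G s) ⊆ G.filter (Near R s) := by
      intro s' hs'
      rw [Finset.mem_filter] at hs' ⊢
      obtain ⟨t, ht, htn, htv⟩ := mem_reach.1 hv
      obtain ⟨t', ht', htn', htv'⟩ := mem_reach.1 hs'.2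
      refine ⟨hs'.1, ?_⟩
      have h1 := htn.trans (hG _ hs) (hG _ ht) (hG _ ht') (near_of_mem_windows htv htv')
      exact h1.trans (hG _ hs) (hG _ ht') (hG _ hs'.1) htn'.symm
    have hnn : ∀ s, 0 ≤ share R G s := fun s => by unfold share; split_ifs <;> norm_num
    refine (Finset.sum_le_sum_of_subset_of_nonneg hsub fun s _ _ => hnn s).trans ?_
    by_cases hsh : ∃ s' ∈ G, s' ≠ s ∧ Near R s s'
    · have hone : ∀ t ∈ G.filter (Near R s), share R G t = 1 := by
        intro t ht
        rw [Finset.mem_filter] at ht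
        unfold share
        rw [if_pos]
        by_cases hts : t = s
        · rw [hts]; exact hsh
        · exact ⟨s, hs, fun h => hts h.symm, ht.2.symm⟩
      rw [Finset.sum_congr rfl hone]
      have hcard : (G.filter (Near R s)).card ≤ (Finset.univ : Finset Bool).card := by
        apply Finset.card_le_card_of_injOn (fun t => t.2) (fun _ _ => Finset.mem_univ _)
        intro t ht t' ht' hb
        simp only [Finset.coe_filter, Set.mem_ofPred_eq] at ht ht'
        have hn := ht.2.symm.trans (hG _ ht.1) (hG _ hs) (hG _ ht'.1) ht'.2
        exact eq_of_left_close (hG _ ht.1) (hG _ ht'.1) hb (by simp [hn.1]) (by linarith [hn.2])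
      simp only [Finset.card_univ, Fintype.card_bool] at hcard
      simp only [Finset.sum_const, nsmul_eq_mul, mul_one]
      exact_mod_cast hcard
    · have : G.filter (Near R s) = {s} := by
        ext t
        rw [Finset.mem_filter, Finset.mem_singleton]
        constructor
        · rintro ⟨ht, hn⟩
          by_contra hne
          exact hsh ⟨t, ht, hne, hn⟩
        · rintro rfl
          exact ⟨hs, Near.refl _ _⟩
      rw [this, Finset.sum_singleton]
      unfold share
      split_ifs <;> norm_num
  · push Not at h
    rw [Finset.filter_false_of_mem h]
    norm_num

open Classical in
-- Double counting: each tip collects 4 by `four_le_share_mul`, and each cell is used with total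
-- weight at most 2.
theorem two_mul_card_le_sum_windows (hR : 3 ≤ R) (hG : ∀ s ∈ G, IsGood R F s)
    (hpos : ∀ s ∈ G, ∀ x y, left R s - 1 ≤ x → x ≤ left R s + 4 → |y - s.1.2| ≤ 1 →
      3 ≤ cappedSum R F (x, y)) :
    2 * (G.card : ℤ) ≤ ∑ v ∈ G.biUnion (window R), (cappedSum R F v - 3) := by
  have h1 : ∑ s ∈ G, (4 : ℤ) ≤
      ∑ s ∈ G, share R G s * ∑ v ∈ reach R G s, (cappedSum R F v - 3) :=
    Finset.sum_le_sum fun s hs => four_le_share_mul hR hG hpos hs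
  have hsub : ∀ s ∈ G, reach R G s ⊆ G.biUnion (window R) := fun s _ =>
    Finset.biUnion_subset_biUnion_of_subset_left _ (Finset.filter_subset _ _)
  have h2 : ∑ s ∈ G, share R G s * ∑ v ∈ reach R G s, (cappedSum R F v - 3) =
      ∑ v ∈ G.biUnion (window R), (cappedSum R F v - 3) *
        ∑ s ∈ G.filter (fun s => v ∈ reach R G s), share R G s := by
    simp only [Finset.mul_sum, Finset.sum_filter]
    rw [Finset.sum_comm]
    refine Finset.sum_congr rfl fun s hs => ?_
    simp only [mul_ite, mul_zero]
    rw [← Finset.sum_filter, Finset.filter_mem_eq_inter, Finset.inter_eq_right.2 (hsub s hs)]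
    exact Finset.sum_congr rfl fun v _ => mul_comm _ _
  have h3 : ∑ v ∈ G.biUnion (window R), (cappedSum R F v - 3) *
        ∑ s ∈ G.filter (fun s => v ∈ reach R G s), share R G s ≤
      ∑ v ∈ G.biUnion (window R), (cappedSum R F v - 3) * 2 := by
    refine Finset.sum_le_sum fun v hv => mul_le_mul_of_nonneg_left (sum_share_le_two hG v) ?_
    obtain ⟨s, hs, hv⟩ := Finset.mem_biUnion.1 hv
    rw [mem_window] at hv
    have := hpos s hs v.1 v.2 hv.1.1 hv.1.2 (by simp [hv.2])
    simpa using this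
  rw [← Finset.sum_mul] at h3
  simp only [Finset.sum_const, nsmul_eq_mul] at h1
  linarith

end

/-! ### Counting bad tips -/

/-- The box `[-n, n]²`. -/
def boxFinset (n : ℤ) : Finset (ℤ × ℤ) := Finset.Icc (-n) n ×ˢ Finset.Icc (-n) n

theorem mem_boxFinset {n : ℤ} {v : ℤ × ℤ} :
    v ∈ boxFinset n ↔ (-n ≤ v.1 ∧ v.1 ≤ n) ∧ -n ≤ v.2 ∧ v.2 ≤ n := by
  simp [boxFinset, Finset.mem_product]

open Classical in
-- A crowded tower accounts for its own 2 tips, for 4 tips met by its vertical tips (two directions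
-- each), and for 2 tips whose window comes within distance 2 of it. Any two tips charged alike
-- belong to towers within distance 13, so they agree. The margin R + 20 keeps the crowded towers
-- responsible inside the box of radius `n - 2`.
theorem card_bad_le {R : ℤ} (hR : 0 ≤ R) (F : Finset (ℤ × ℤ)) (n : ℤ) :
    (((F ∩ boxFinset (n - (R + 20))) ×ˢ Finset.univ).filter
      (fun s : (ℤ × ℤ) × Bool => ¬ IsGood R F s)).card ≤
      8 * (crowded F ∩ boxFinset (n - 2)).card := by
  set C := crowded F ∩ boxFinset (n - 2) with hC
  set H : Finset ((ℤ × ℤ) × Bool) := (F ∩ boxFinset (n - (R + 20))) ×ˢ Finset.univ with hH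
  have hmem : ∀ s ∈ H, s.1 ∈ F ∧ (-(n - (R + 20)) ≤ s.1.1 ∧ s.1.1 ≤ n - (R + 20)) ∧
      -(n - (R + 20)) ≤ s.1.2 ∧ s.1.2 ≤ n - (R + 20) := by
    intro s hs
    rw [hH, Finset.mem_product, Finset.mem_inter, mem_boxFinset] at hs
    exact hs.1
  have hleft : ∀ s : (ℤ × ℤ) × Bool, s.1.1 - R - 2 ≤ left R s ∧ left R s ≤ s.1.1 + R := by
    intro s
    simp only [left, tip]
    split_ifs <;> omega
  set B₁ : Finset ((ℤ × ℤ) × Bool) := C ×ˢ Finset.univ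
  set B₂ := H.filter fun s => s.1 ∉ crowded F ∧ ∃ Q ∈ C, ∃ b, ∃ i, 0 ≤ i ∧ i ≤ 3 ∧
    vertical R Q b (left R s + i, s.1.2) ≠ 0
  set B₃ := H.filter fun s => s.1 ∉ crowded F ∧ ∃ Q ∈ C, ∃ i, -1 ≤ i ∧ i ≤ 4 ∧
    l1 (left R s + i, s.1.2) Q ≤ 2
  have hsub : H.filter (fun s => ¬ IsGood R F s) ⊆ B₁ ∪ (B₂ ∪ B₃) := by
    intro s hs
    rw [Finset.mem_filter] at hs
    obtain ⟨hsH, hbad⟩ := hs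
    obtain ⟨hF, hx, hy⟩ := hmem s hsH
    have hl := hleft s
    rw [Finset.mem_union, Finset.mem_union]
    by_cases hc : s.1 ∈ crowded F
    · left
      rw [Finset.mem_product]
      refine ⟨Finset.mem_inter.2 ⟨hc, mem_boxFinset.2 ?_⟩, Finset.mem_univ _⟩
      omega
    right
    simp only [IsGood, hF, hc, not_false_eq_true, true_and, not_and_or, not_forall, not_lt] at hbad
    rcases hbad with ⟨Q, hQ, b, i, hi0, hi3, hv⟩ | ⟨Q, hQ, i, hi0, hi4, hd⟩
    · left
      refine Finset.mem_filter.2 ⟨hsH, hc, Q, Finset.mem_inter.2 ⟨hQ, mem_boxFinset.2 ?_⟩, b, i,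
        hi0, hi3, hv⟩
      have := eq_row_of_vertical_ne_zero hv
      simp only [tip] at this
      cases b <;> simp at this <;> omega
    · right
      refine Finset.mem_filter.2 ⟨hsH, hc, Q, Finset.mem_inter.2 ⟨hQ, mem_boxFinset.2 ?_⟩, i,
        hi0, hi4, hd⟩
      simp only [l1] at hd
      have h1 := abs_le.1 (show |left R s + i - Q.1| ≤ 2 by linarith [abs_nonneg (s.1.2 - Q.2)])
      have h2 := abs_le.1 (show |s.1.2 - Q.2| ≤ 2 by linarith [abs_nonneg (left R s + i - Q.1)])
      omega
  have hclose : ∀ s ∈ H, ∀ s' ∈ H, s.1 ∉ crowded F → s'.2 = s.2 →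
      |left R s' - left R s| + |s'.1.2 - s.1.2| ≤ 13 → s = s' := by
    intro s hs s' hs' hc hb hd
    refine (Prod.ext (eq_of_not_crowded (hmem s hs).1 hc (hmem s' hs').1 ?_) hb).symm
    have : s'.1.1 - s.1.1 = left R s' - left R s := by
      simp only [left, tip, hb]; split_ifs <;> ring
    rw [this]
    exact hd
  have h₁ : B₁.card = 2 * C.card := by
    rw [Finset.card_product, Finset.card_univ, Fintype.card_bool, mul_comm]
  have h₂ : B₂.card ≤ (C ×ˢ (Finset.univ : Finset (Bool × Bool))).card := by
    apply Finset.card_le_card_of_forall_subsingleton (fun s q => s.2 = q.2.1 ∧ ∃ i, 0 ≤ i ∧ i ≤ 3 ∧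
      vertical R q.1 q.2.2 (left R s + i, s.1.2) ≠ 0)
    · intro s hs
      obtain ⟨hsH, hc, Q, hQ, b, i, hi⟩ := Finset.mem_filter.1 hs
      exact ⟨(Q, s.2, b), by simp [hQ], rfl, i, hi⟩
    · rintro ⟨Q, b', b⟩ - s ⟨hs, hb, i, hi0, hi3, hv⟩ s' ⟨hs', hb', j, hj0, hj3, hv'⟩
      rw [Finset.mem_filter] at hs hs'
      apply hclose s hs.1 s' hs'.1 hs.2.1 (hb'.trans hb.symm)
      have h1 := eq_row_of_vertical_ne_zero hv
      have h2 := eq_row_of_vertical_ne_zero hv'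
      simp only at h1 h2
      have h3 : |left R s' - left R s| ≤ 3 := by rw [abs_le]; omega
      have h4 : |s'.1.2 - s.1.2| ≤ 3 := by rw [abs_le]; omega
      linarith
  have h₃ : B₃.card ≤ (C ×ˢ (Finset.univ : Finset Bool)).card := by
    apply Finset.card_le_card_of_forall_subsingleton (fun s q => s.2 = q.2 ∧ ∃ i, -1 ≤ i ∧ i ≤ 4 ∧
      l1 (left R s + i, s.1.2) q.1 ≤ 2)
    · intro s hs
      obtain ⟨hsH, hc, Q, hQ, i, hi⟩ := Finset.mem_filter.1 hs
      exact ⟨(Q, s.2), by simp [hQ], rfl, i, hi⟩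
    · rintro ⟨Q, b⟩ - s ⟨hs, hb, i, hi0, hi3, hv⟩ s' ⟨hs', hb', j, hj0, hj3, hv'⟩
      rw [Finset.mem_filter] at hs hs'
      apply hclose s hs.1 s' hs'.1 hs.2.1 (hb'.trans hb.symm)
      simp only [l1] at hv hv'
      have t1 := abs_sub_le (left R s' + j) Q.1 (left R s + i)
      have t2 := abs_sub_le s'.1.2 Q.2 s.1.2
      rw [abs_sub_comm Q.1] at t1
      rw [abs_sub_comm Q.2] at t2
      have t3 := abs_sub_le (left R s') (left R s' + j - (left R s + i) + left R s) (left R s)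
      rw [add_sub_cancel_right] at t3
      have t4 : |left R s' - (left R s' + j - (left R s + i) + left R s)| ≤ 5 := by
        rw [abs_le]; omega
      linarith
  refine (Finset.card_le_card hsub).trans ((Finset.card_union_le _ _).trans ?_)
  have h₄ := Finset.card_union_le B₂ B₃
  simp only [Finset.card_product, Finset.card_univ, Fintype.card_prod, Fintype.card_bool] at h₂ h₃
  omega

/-! ### Ball sizes and the excess around crowded towers -/

/-- In the rotated coordinates x + y, x - y the two parity classes of the ball become squares of
sides j + 1 and j. -/
theorem card_le_of_l1_le {A : Finset (ℤ × ℤ)} {P : ℤ × ℤ} {j : ℤ} (hj : 0 ≤ j)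
    (h : ∀ v ∈ A, l1 v P ≤ j) : (A.card : ℤ) ≤ 2 * j ^ 2 + 2 * j + 1 := by
  classical
  have hb : ∀ v ∈ A, (0 ≤ v.1 - P.1 + (v.2 - P.2) + j ∧ v.1 - P.1 + (v.2 - P.2) + j ≤ 2 * j) ∧
      0 ≤ v.1 - P.1 - (v.2 - P.2) + j ∧ v.1 - P.1 - (v.2 - P.2) + j ≤ 2 * j := by
    intro v hv
    have := h v hv
    simp only [l1] at this
    have h1 := abs_le.1 ((abs_add_le (v.1 - P.1) (v.2 - P.2)).trans this)
    have h2 := abs_le.1 ((abs_sub (v.1 - P.1) (v.2 - P.2)).trans this)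
    omega
  set f : ℤ × ℤ → ℤ × ℤ := fun v =>
    ((v.1 - P.1 + (v.2 - P.2) + j) / 2, (v.1 - P.1 - (v.2 - P.2) + j) / 2)
  set p : ℤ × ℤ → Prop := fun v => (v.1 - P.1 + (v.2 - P.2) + j) % 2 = 0
  have h1 : (A.filter p).card ≤ (Finset.Icc 0 j ×ˢ Finset.Icc 0 j).card := by
    apply Finset.card_le_card_of_injOn f
    · intro v hv
      have hv' := Finset.mem_filter.1 hv
      have := hb v hv'.1
      simp only [f, Finset.coe_product, Finset.coe_Icc, Set.mem_prod, Set.mem_Icc]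
      omega
    · intro v hv w hw hvw
      have hv' := (Finset.mem_filter.1 hv).2
      have hw' := (Finset.mem_filter.1 hw).2
      simp only [f, p, Prod.mk.injEq] at hvw hv' hw'
      ext <;> omega
  have h2 : (A.filter (fun v => ¬ p v)).card ≤
      (Finset.Icc 0 (j - 1) ×ˢ Finset.Icc 0 (j - 1)).card := by
    apply Finset.card_le_card_of_injOn f
    · intro v hv
      have hv' := Finset.mem_filter.1 hv
      have := hb v hv'.1
      have hp := hv'.2
      simp only [p] at hp
      simp only [f, Finset.coe_product, Finset.coe_Icc, Set.mem_prod, Set.mem_Icc]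
      omega
    · intro v hv w hw hvw
      have hv' := (Finset.mem_filter.1 hv).2
      have hw' := (Finset.mem_filter.1 hw).2
      simp only [f, p, Prod.mk.injEq] at hvw hv' hw'
      ext <;> omega
  rw [Finset.card_product, Int.card_Icc] at h1 h2
  rw [← Finset.card_filter_add_card_filter_not p]
  have e1 : ((j + 1 - 0).toNat : ℤ) = j + 1 := by omega
  have e2 : ((j - 1 + 1 - 0).toNat : ℤ) = j := by omega
  have h1' : ((A.filter p).card : ℤ) ≤ (j + 1) * (j + 1) := by
    have : ((A.filter p).card : ℤ) ≤ ((j + 1 - 0).toNat * (j + 1 - 0).toNat : ℕ) := by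
      exact_mod_cast h1
    rwa [Nat.cast_mul, e1] at this
  have h2' : ((A.filter (fun v => ¬ p v)).card : ℤ) ≤ j * j := by
    have : ((A.filter (fun v => ¬ p v)).card : ℤ) ≤
        ((j - 1 + 1 - 0).toNat * (j - 1 + 1 - 0).toNat : ℕ) := by exact_mod_cast h2
    rwa [Nat.cast_mul, e2] at this
  push_cast
  linarith

/-- The truncated signal is the sum of the indicators of the balls of radii R - 1, R and R + 1. -/
theorem sum_capped_le {R : ℤ} (hR : 1 ≤ R) (A : Finset (ℤ × ℤ)) (P : ℤ × ℤ) :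
    ∑ v ∈ A, capped R (l1 v P) ≤ 3 * (2 * R ^ 2 + 2 * R + 1) + 4 := by
  have h : ∀ v ∈ A, capped R (l1 v P) = (if l1 v P ≤ R - 1 then 1 else 0) +
      (if l1 v P ≤ R then 1 else 0) + if l1 v P ≤ R + 1 then 1 else 0 := by
    intro v _
    unfold capped
    split_ifs <;> omega
  rw [Finset.sum_congr rfl h, Finset.sum_add_distrib, Finset.sum_add_distrib]
  simp only [Finset.sum_boole]
  have h1 := card_le_of_l1_le (A := A.filter fun v => l1 v P ≤ R - 1) (j := R - 1) (P := P)
    (by omega) fun v hv => (Finset.mem_filter.1 hv).2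
  have h2 := card_le_of_l1_le (A := A.filter fun v => l1 v P ≤ R) (j := R) (P := P)
    (by omega) fun v hv => (Finset.mem_filter.1 hv).2
  have h3 := card_le_of_l1_le (A := A.filter fun v => l1 v P ≤ R + 1) (j := R + 1) (P := P)
    (by omega) fun v hv => (Finset.mem_filter.1 hv).2
  nlinarith

theorem capped_nonneg (R k : ℤ) : 0 ≤ capped R k := le_max_left _ _

theorem l1_triangle (u v w : ℤ × ℤ) : l1 u w ≤ l1 u v + l1 v w := by
  have h1 := abs_sub_le u.1 v.1 w.1
  have h2 := abs_sub_le u.2 v.2 w.2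
  simp only [l1]
  linarith

theorem l1_comm (u v : ℤ × ℤ) : l1 u v = l1 v u := by
  simp only [l1, abs_sub_comm]

/-- The points of `A` within distance `2` of `C`. -/
def nbhd (A C : Finset (ℤ × ℤ)) : Finset (ℤ × ℤ) := by
  classical exact A.filter fun v => ∃ Q ∈ C, l1 v Q ≤ 2

theorem mem_nbhd {A C : Finset (ℤ × ℤ)} {v : ℤ × ℤ} :
    v ∈ nbhd A C ↔ v ∈ A ∧ ∃ Q ∈ C, l1 v Q ≤ 2 := by
  classical
  unfold nbhd
  rw [Finset.mem_filter]

theorem thirteen_mul_card_le (A C : Finset (ℤ × ℤ)) (hA : ∀ Q ∈ C, ∀ v, l1 v Q ≤ 2 → v ∈ A) :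
    13 * C.card ≤ ∑ v ∈ nbhd A C,
      (C.filter fun Q => l1 v Q ≤ 2).card := by
  simp only [Finset.card_filter (fun Q => l1 _ Q ≤ 2)]
  rw [Finset.sum_comm, mul_comm, ← smul_eq_mul, ← Finset.sum_const]
  refine Finset.sum_le_sum fun Q hQ => ?_
  rw [← Finset.card_filter]
  -- This 13 is the size of a ball of radius 2, unrelated to the distance 13 in `crowded`.
  have h13 : ((Finset.Icc (-2 : ℤ) 2 ×ˢ Finset.Icc (-2 : ℤ) 2).filter
      fun w : ℤ × ℤ => |w.1| + |w.2| ≤ 2).card = 13 := by decide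
  rw [← h13]
  apply Finset.card_le_card_of_injOn fun w => w + Q
  · intro w hw
    have hw' := (Finset.mem_filter.1 hw).2
    have : l1 (w + Q) Q ≤ 2 := by simpa [l1] using hw'
    exact Finset.mem_filter.2 ⟨mem_nbhd.2 ⟨hA Q hQ _ this, Q, hQ, this⟩, this⟩
  · intro w _ w' _ h
    exact add_right_cancel h

/-- Within distance 2 of a crowded tower, the tower and its companion are at distance at most 2 + 13
≤ R - 1, hence both give the full 3. This is where `16 ≤ R`, that is t > 17, is needed. -/
theorem sixteen_mul_card_crowded_le {R : ℤ} (hR : 16 ≤ R) (F : Finset (ℤ × ℤ)) (n : ℤ) :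
    16 * ((crowded F ∩ boxFinset (n - 2)).card : ℤ) ≤
      ∑ v ∈ nbhd (boxFinset n) (crowded F ∩ boxFinset (n - 2)),
        (cappedSum R F v - 3) := by
  set C := crowded F ∩ boxFinset (n - 2)
  have h1 := thirteen_mul_card_le (boxFinset n) C (by
    intro Q hQ v hv
    have hb := mem_boxFinset.1 (Finset.mem_inter.1 hQ).2
    rw [mem_boxFinset]
    simp only [l1] at hv
    have h1 := abs_le.1 (show |v.1 - Q.1| ≤ 2 by linarith [abs_nonneg (v.2 - Q.2)])
    have h2 := abs_le.1 (show |v.2 - Q.2| ≤ 2 by linarith [abs_nonneg (v.1 - Q.1)])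
    omega)
  -- With K ≥ 2 towers at full strength the excess is at least 3K - 3 ≥ 3K/2. Summed against `h1`
  -- this gives 39/2 per crowded tower, more than 16.
  have h2 : ∀ v ∈ nbhd (boxFinset n) C,
      3 * (((C.filter fun Q => l1 v Q ≤ 2).card : ℕ) : ℤ) ≤ 2 * (cappedSum R F v - 3) := by
    intro v hv
    obtain ⟨-, Q, hQ, hvQ⟩ := mem_nbhd.1 hv
    set K := F.filter fun P => l1 v P ≤ R - 1
    have hK : 3 * (K.card : ℤ) ≤ cappedSum R F v := by
      rw [mul_comm, ← nsmul_eq_mul, ← Finset.sum_const]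
      refine (Finset.sum_le_sum fun P hP => ?_).trans
        (Finset.sum_le_sum_of_subset_of_nonneg (Finset.filter_subset _ _)
          fun P _ _ => capped_nonneg _ _)
      have := (Finset.mem_filter.1 hP).2
      unfold capped
      omega
    have hCK : (C.filter fun Q => l1 v Q ≤ 2) ⊆ K := by
      intro P hP
      obtain ⟨hP, hd⟩ := Finset.mem_filter.1 hP
      exact Finset.mem_filter.2 ⟨(mem_crowded.1 (Finset.mem_inter.1 hP).1).1, by omega⟩
    have hle := Finset.card_le_card hCK
    have htwo : 2 ≤ K.card := by
      obtain ⟨hF, Q', hQ', hne, hd⟩ := mem_crowded.1 (Finset.mem_inter.1 hQ).1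
      refine Finset.one_lt_card.2 ⟨Q, Finset.mem_filter.2 ⟨hF, by omega⟩, Q',
        Finset.mem_filter.2 ⟨hQ', ?_⟩, hne.symm⟩
      have := l1_triangle v Q Q'
      rw [l1_comm Q Q'] at this
      omega
    omega
  have h3 := Finset.sum_le_sum h2
  rw [← Finset.mul_sum, ← Finset.mul_sum, ← Nat.cast_sum] at h3
  have h1' : (13 * C.card : ℤ) ≤ ((∑ v ∈ nbhd (boxFinset n) C,
      (C.filter fun Q => l1 v Q ≤ 2).card : ℕ) : ℤ) := by exact_mod_cast h1
  linarith

/-! ### The counting inequality for towers in a box -/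

open Classical in
/-- On average the truncated signals exceed `3` by at least `4` per tower. -/
theorem four_mul_card_le_sum_excess {R : ℤ} (hR : 16 ≤ R) (F : Finset (ℤ × ℤ)) (n : ℤ)
    (h : ∀ v ∈ boxFinset n, 3 ≤ cappedSum R F v) :
    4 * ((F ∩ boxFinset (n - (R + 20))).card : ℤ) ≤
      ∑ v ∈ boxFinset n, (cappedSum R F v - 3) := by
  set H : Finset ((ℤ × ℤ) × Bool) := (F ∩ boxFinset (n - (R + 20))) ×ˢ Finset.univ with hH
  set G := H.filter (IsGood R F)
  have hbad : (H.filter fun s => ¬ IsGood R F s).card ≤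
      8 * (crowded F ∩ boxFinset (n - 2)).card := by
    convert card_bad_le (by omega : 0 ≤ R) F n
  have hsplit : G.card + (H.filter fun s => ¬ IsGood R F s).card = H.card := by
    rw [← Finset.card_filter_add_card_filter_not (s := H) (IsGood R F)]
  have hcard : H.card = (F ∩ boxFinset (n - (R + 20))).card * 2 := by
    rw [hH, Finset.card_product, Finset.card_univ, Fintype.card_bool]
  rw [hcard] at hsplit
  have hG : ∀ s ∈ G, IsGood R F s := fun s hs => (Finset.mem_filter.1 hs).2
  have hbox : ∀ s ∈ G, ∀ x y, left R s - 1 ≤ x → x ≤ left R s + 4 → |y - s.1.2| ≤ 1 →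
      (x, y) ∈ boxFinset n := by
    intro s hs x y hx1 hx2 hy
    have hb := Finset.mem_product.1 (Finset.mem_filter.1 hs).1
    have hb2 := mem_boxFinset.1 (Finset.mem_inter.1 hb.1).2
    have hl : s.1.1 - R - 2 ≤ left R s ∧ left R s ≤ s.1.1 + R := by
      simp only [left, tip]
      split_ifs <;> omega
    rw [abs_le] at hy
    rw [mem_boxFinset]
    dsimp only
    omega
  have h1 := two_mul_card_le_sum_windows (by omega) hG
    fun s hs x y hx1 hx2 hy => h _ (hbox s hs x y hx1 hx2 hy)
  have h2 := sixteen_mul_card_crowded_le hR F n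
  set X := nbhd (boxFinset n) (crowded F ∩ boxFinset (n - 2))
  -- Good windows avoid the neighbourhoods of crowded towers, so the two lower bounds add up.
  have hsub : G.biUnion (window R) ⊆ boxFinset n \ X := by
    intro v hv
    obtain ⟨s, hs, hv⟩ := Finset.mem_biUnion.1 hv
    rw [mem_window] at hv
    refine Finset.mem_sdiff.2 ⟨hbox s hs v.1 v.2 hv.1.1 hv.1.2 (by simp [hv.2]), fun hvX => ?_⟩
    obtain ⟨-, Q, hQ, hd⟩ := mem_nbhd.1 hvX
    have := (hG s hs).2.2.2 Q (Finset.mem_inter.1 hQ).1 (v.1 - left R s) (by omega) (by omega)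
    rw [add_sub_cancel, ← hv.2] at this
    exact absurd hd (not_le.2 this)
  have h3 : ∑ v ∈ G.biUnion (window R), (cappedSum R F v - 3) ≤
      ∑ v ∈ boxFinset n \ X, (cappedSum R F v - 3) :=
    Finset.sum_le_sum_of_subset_of_nonneg hsub fun v hv _ =>
      sub_nonneg.2 (h v (Finset.mem_sdiff.1 hv).1)
  have h4 := Finset.sum_sdiff (f := fun v => cappedSum R F v - 3)
    (fun v hv => (mem_nbhd.1 hv).1 : X ⊆ boxFinset n)
  -- Excess 2 per good tip and 16 = 2 · 8 per crowded tower replaces the 2 lost at each bad tip.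
  have h5 : (2 * (F ∩ boxFinset (n - (R + 20))).card : ℤ) ≤
      G.card + 8 * (crowded F ∩ boxFinset (n - 2)).card := by
    have : (F ∩ boxFinset (n - (R + 20))).card * 2 ≤
      G.card + 8 * (crowded F ∩ boxFinset (n - 2)).card := by omega
    have : (((F ∩ boxFinset (n - (R + 20))).card * 2 : ℕ) : ℤ) ≤
      ((G.card + 8 * (crowded F ∩ boxFinset (n - 2)).card : ℕ) : ℤ) := by exact_mod_cast this
    push_cast at this
    linarith
  linarith

theorem card_boxFinset {n : ℤ} (hn : 0 ≤ n) : ((boxFinset n).card : ℤ) = (2 * n + 1) ^ 2 := by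
  rw [boxFinset, Finset.card_product, Int.card_Icc]
  push_cast
  rw [Int.toNat_of_nonneg (by omega)]
  ring

theorem card_towers_ge {R : ℤ} (hR : 16 ≤ R) (F : Finset (ℤ × ℤ)) {n : ℤ} (hn : 0 ≤ n)
    (h : ∀ v ∈ boxFinset n, 3 ≤ cappedSum R F v) :
    3 * (2 * n + 1) ^ 2 + 4 * ((F ∩ boxFinset (n - (R + 20))).card : ℤ) ≤
      (3 * (2 * R ^ 2 + 2 * R + 1) + 4) * F.card := by
  have h1 := four_mul_card_le_sum_excess hR F n h
  rw [Finset.sum_sub_distrib, Finset.sum_const, nsmul_eq_mul, card_boxFinset hn] at h1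
  have h2 : ∑ v ∈ boxFinset n, cappedSum R F v ≤
      ∑ P ∈ F, (3 * (2 * R ^ 2 + 2 * R + 1) + 4) := by
    simp only [cappedSum]
    rw [Finset.sum_comm]
    exact Finset.sum_le_sum fun P _ => sum_capped_le (by omega) _ _
  rw [Finset.sum_const, nsmul_eq_mul] at h2
  linarith

/-! ### The grid metric and the two kinds of domination -/

theorem edist_hasse_add_le (a : ℤ) (k : ℕ) : (SimpleGraph.hasse ℤ).edist a (a + k) ≤ k := by
  induction k with
  | zero => simp
  | succ k ih =>
    refine (SimpleGraph.edist_triangle (v := a + k)).trans ?_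
    push_cast
    refine add_le_add ih (le_of_eq ?_)
    rw [SimpleGraph.edist_eq_one_iff_adj, SimpleGraph.hasse_adj]
    left
    rw [Order.covBy_iff_add_one_eq]
    ring

theorem natAbs_le_length {a b : ℤ} (w : (SimpleGraph.hasse ℤ).Walk a b) :
    (a - b).natAbs ≤ w.length := by
  induction w with
  | nil => simp
  | cons h p ih =>
    rw [SimpleGraph.hasse_adj, Order.covBy_iff_add_one_eq, Order.covBy_iff_add_one_eq] at h
    rw [SimpleGraph.Walk.length_cons]
    omega

theorem edist_hasse (a b : ℤ) : (SimpleGraph.hasse ℤ).edist a b = ((a - b).natAbs : ℕ∞) := by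
  apply le_antisymm
  · rcases le_total a b with h | h
    · obtain ⟨k, hk⟩ := Int.eq_ofNat_of_zero_le (sub_nonneg.2 h)
      obtain rfl : b = a + k := by omega
      rw [show (a - (a + k)).natAbs = k by omega]
      exact edist_hasse_add_le a k
    · obtain ⟨k, hk⟩ := Int.eq_ofNat_of_zero_le (sub_nonneg.2 h)
      obtain rfl : a = b + k := by omega
      rw [show (b + k - b).natAbs = k by omega, SimpleGraph.edist_comm]
      exact edist_hasse_add_le b k
  · obtain ⟨w, hw⟩ := ((SimpleGraph.hasse_preconnected_of_succ ℤ) a b).exists_walk_length_eq_edist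
    rw [← hw]
    exact_mod_cast natAbs_le_length w

theorem edist_grid (u v : ℤ × ℤ) : grid.edist u v = ((l1 u v).toNat : ℕ∞) := by
  rw [grid, SimpleGraph.edist_boxProd, edist_hasse, edist_hasse, ← Nat.cast_add]
  congr 1
  simp only [l1, Int.abs_eq_natAbs]
  omega

theorem signal_grid (t : ℕ) (u v : ℤ × ℤ) :
    signal grid t u v = ((t - (l1 u v).toNat : ℕ) : ℝ≥0∞) := by
  rw [signal, edist_grid, ENat.toENNReal_coe]
  exact (ENNReal.natCast_sub _ _).symm

theorem sum_signal_eq {T : Set (ℤ × ℤ)} {t : ℕ} {F : Finset (ℤ × ℤ)} {v : ℤ × ℤ}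
    (hF : ∀ P ∈ F, P ∈ T) (hTF : ∀ P ∈ T, l1 P v < t → P ∈ F) :
    ∑' u : T, signal grid t u v = ((∑ P ∈ F, (t - (l1 P v).toNat) : ℕ) : ℝ≥0∞) := by
  rw [tsum_subtype T fun u => signal grid t u v, tsum_eq_sum (s := F), Nat.cast_sum]
  · exact Finset.sum_congr rfl fun P hP => by rw [Set.indicator_of_mem (hF P hP), signal_grid]
  · intro P hP
    by_cases hPT : P ∈ T
    · rw [Set.indicator_of_mem hPT, signal_grid, Nat.cast_eq_zero]
      have := mt (hTF P hPT) hP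
      omega
    · rw [Set.indicator_of_notMem hPT]

/-- Either one signal reaches 3, and its truncation suffices, or truncation changes nothing. -/
theorem three_le_cappedSum {T : Set (ℤ × ℤ)} {R : ℕ} {F : Finset (ℤ × ℤ)} {v : ℤ × ℤ}
    (hT : IsDominating grid (R + 2) 3 T)
    (hF : ∀ P ∈ F, P ∈ T) (hTF : ∀ P ∈ T, l1 P v < (R + 2 : ℕ) → P ∈ F) :
    3 ≤ cappedSum R F v := by
  have h := hT v
  rw [sum_signal_eq hF hTF] at h
  have h' : 3 ≤ ∑ P ∈ F, (R + 2 - (l1 P v).toNat) := by exact_mod_cast h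
  by_cases hbig : ∃ P ∈ F, 3 ≤ R + 2 - (l1 P v).toNat
  · obtain ⟨P, hP, h3⟩ := hbig
    have h4 : capped R (l1 v P) = 3 := by
      rw [l1_comm]
      unfold capped
      omega
    rw [← h4]
    exact Finset.single_le_sum (f := fun P => capped R (l1 v P)) (fun _ _ => capped_nonneg _ _) hP
  · push Not at hbig
    have h5 : cappedSum R F v = ((∑ P ∈ F, (R + 2 - (l1 P v).toNat) : ℕ) : ℤ) := by
      rw [Nat.cast_sum, cappedSum]
      refine Finset.sum_congr rfl fun P hP => ?_
      have := hbig P hP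
      have hnn : 0 ≤ l1 P v := add_nonneg (abs_nonneg _) (abs_nonneg _)
      rw [l1_comm]
      unfold capped
      omega
    rw [h5]
    exact_mod_cast h'

theorem isDominating_one_iff {T : Set (ℤ × ℤ)} {R : ℕ} :
    IsDominating grid (R + 1) 1 T ↔ ∀ v, ∃ u ∈ T, l1 u v ≤ R := by
  constructor
  · intro hT v
    by_contra! hv
    have h := hT v
    rw [sum_signal_eq (F := ∅) (by simp) fun P hP hlt => absurd (hv P hP) (by push_cast at hlt; omega)]
      at h
    simp at h
  · intro h v
    obtain ⟨u, hu, hd⟩ := h v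
    refine le_trans ?_ (ENNReal.le_tsum ⟨u, hu⟩)
    rw [signal_grid]
    have hnn : 0 ≤ l1 u v := add_nonneg (abs_nonneg _) (abs_nonneg _)
    have : 1 ≤ R + 1 - (l1 u v).toNat := by omega
    exact_mod_cast this

theorem isDominating_three_of_one {T : Set (ℤ × ℤ)} {R : ℕ} (h : IsDominating grid (R + 1) 1 T) :
    IsDominating grid (R + 2) 3 T := by
  rw [isDominating_one_iff] at h
  intro v
  obtain ⟨u, hu, hd⟩ := h v
  have hnn : 0 ≤ l1 u v := add_nonneg (abs_nonneg _) (abs_nonneg _)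
  by_cases hR : l1 u v < R
  · refine le_trans ?_ (ENNReal.le_tsum ⟨u, hu⟩)
    rw [signal_grid]
    have : 3 ≤ R + 2 - (l1 u v).toNat := by omega
    exact_mod_cast this
  · have hw : ∃ w : ℤ × ℤ, l1 w v = 1 ∧ (R : ℤ) < l1 u w := by
      rcases le_total u.1 v.1 with hle | hle
      · refine ⟨(v.1 + 1, v.2), by simp [l1], ?_⟩
        simp only [l1] at hR ⊢
        rw [abs_of_nonpos (by omega)] at hR ⊢
        omega
      · refine ⟨(v.1 - 1, v.2), by simp [l1], ?_⟩
        simp only [l1] at hR ⊢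
        rw [abs_of_nonneg (by omega)] at hR ⊢
        omega
    obtain ⟨w, hw1, hw2⟩ := hw
    obtain ⟨u', hu', hd'⟩ := h w
    have hne : (⟨u, hu⟩ : T) ≠ ⟨u', hu'⟩ := by
      intro heq
      rw [Subtype.mk.injEq] at heq
      rw [heq] at hw2
      omega
    refine le_trans ?_ (ENNReal.sum_le_tsum {⟨u, hu⟩, ⟨u', hu'⟩})
    rw [Finset.sum_pair hne, signal_grid, signal_grid]
    have hnn' : 0 ≤ l1 u' v := add_nonneg (abs_nonneg _) (abs_nonneg _)
    have := l1_triangle u' w v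
    have : 3 ≤ R + 2 - (l1 u v).toNat + (R + 2 - (l1 u' v).toNat) := by omega
    exact_mod_cast this

/-! ### The perfect covering -/

/-- The towers of a perfect covering of the grid by balls of radius `R`. -/
def perfectTowers (R : ℕ) : Set (ℤ × ℤ) :=
  {u | (2 * R ^ 2 + 2 * R + 1 : ℤ) ∣ u.1 + (2 * R + 1) * u.2}

/-- Write the residue as a + (2R+1)b with |a| ≤ R and 0 ≤ b ≤ R. If (a, b) is outside the ball,
subtract (R+1, R) or (-R, R+1), according to the sign of a; both vectors represent N. -/
theorem exists_offset (R : ℕ) (k : ℤ) :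
    ∃ a b : ℤ, |a| + |b| ≤ R ∧ (2 * R ^ 2 + 2 * R + 1 : ℤ) ∣ k - (a + (2 * R + 1) * b) := by
  set N : ℤ := 2 * R ^ 2 + 2 * R + 1 with hN
  have hNpos : 0 < N := by positivity
  set r := k % N
  have hr0 : 0 ≤ r := Int.emod_nonneg _ hNpos.ne'
  have hrN : r < N := Int.emod_lt_of_pos _ hNpos
  have hkr : N ∣ k - r := Int.dvd_self_sub_emod
  set b := (r + R) / (2 * R + 1)
  set a := (r + R) % (2 * R + 1) - R
  have hM : (0 : ℤ) < 2 * R + 1 := by positivity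
  have ha0 : -(R : ℤ) ≤ a := by
    have := Int.emod_nonneg (r + R) hM.ne'
    omega
  have haR : a ≤ R := by
    have := Int.emod_lt_of_pos (r + R) hM
    omega
  have hab : a + (2 * R + 1) * b = r := by
    have := Int.emod_add_mul_ediv (r + R) (2 * R + 1)
    simp only [a, b]
    linarith
  have hb0 : 0 ≤ b := Int.ediv_nonneg (by positivity) hM.le
  have hbR : b ≤ R := by
    have : b < R + 1 := by
      apply Int.ediv_lt_of_lt_mul hM
      nlinarith
    omega
  by_cases h : |a| + |b| ≤ R
  · exact ⟨a, b, h, by rwa [hab]⟩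
  · rw [abs_of_nonneg hb0] at h
    rcases le_total 0 a with ha | ha
    · rw [abs_of_nonneg ha] at h
      refine ⟨a - R - 1, b - R, ?_, ?_⟩
      · rw [abs_of_nonpos (by omega), abs_of_nonpos (by omega)]
        omega
      · have : k - (a - R - 1 + (2 * R + 1) * (b - R)) = k - r + N := by
          rw [← hab, hN]; ring
        rw [this]
        exact dvd_add hkr dvd_rfl
    · rw [abs_of_nonpos ha] at h
      refine ⟨a + R, b - R - 1, ?_, ?_⟩
      · rw [abs_of_nonneg (by omega), abs_of_nonpos (by omega)]
        omega
      · have : k - (a + R + (2 * R + 1) * (b - R - 1)) = k - r + N := by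
          rw [← hab, hN]; ring
        rw [this]
        exact dvd_add hkr dvd_rfl

theorem isDominating_perfectTowers (R : ℕ) : IsDominating grid (R + 1) 1 (perfectTowers R) := by
  rw [isDominating_one_iff]
  intro v
  obtain ⟨a, b, hd, hdvd⟩ := exists_offset R (v.1 + (2 * R + 1) * v.2)
  refine ⟨(v.1 - a, v.2 - b), ?_, ?_⟩
  · rw [perfectTowers, Set.mem_ofPred_eq]
    convert hdvd using 1
    ring
  · simpa [l1] using hd

theorem coe_boxFinset (n : ℕ) : (boxFinset n : Set (ℤ × ℤ)) = box n := by
  simp [boxFinset, box]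

theorem exists_finset_inter_box (T : Set (ℤ × ℤ)) (n : ℕ) :
    ∃ F : Finset (ℤ × ℤ), (F : Set (ℤ × ℤ)) = T ∩ box n ∧ (T ∩ box n).ncard = F.card := by
  have hfin : (T ∩ box n).Finite := by
    rw [← coe_boxFinset]
    exact (Finset.finite_toSet _).inter_of_right _
  exact ⟨hfin.toFinset, hfin.coe_toFinset, Set.ncard_eq_toFinset_card _ hfin⟩

/-- In each row the towers form one residue class modulo N, so a block of N consecutive cells
contains at most one. -/
theorem ncard_perfectTowers_le (R n : ℕ) :
    (2 * R ^ 2 + 2 * R + 1) * (perfectTowers R ∩ box n).ncard ≤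
      (2 * n + (2 * R ^ 2 + 2 * R + 1)) * (2 * n + 1) := by
  obtain ⟨F, hF, hcard⟩ := exists_finset_inter_box (perfectTowers R) n
  rw [hcard]
  set N : ℕ := 2 * R ^ 2 + 2 * R + 1 with hN
  have hNpos : 0 < N := by positivity
  have hmem : ∀ u ∈ F, (N : ℤ) ∣ u.1 + (2 * R + 1) * u.2 ∧ (-(n : ℤ) ≤ u.1 ∧ u.1 ≤ n) ∧
      -(n : ℤ) ≤ u.2 ∧ u.2 ≤ n := by
    intro u hu
    have : u ∈ perfectTowers R ∩ box n := by rw [← hF]; exact hu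
    refine ⟨?_, this.2⟩
    rw [hN]
    exact_mod_cast this.1
  have h1 : F.card ≤ (Finset.Icc (0 : ℤ) ((2 * n / N : ℕ) : ℤ) ×ˢ Finset.Icc (-n : ℤ) n).card := by
    apply Finset.card_le_card_of_injOn fun u : ℤ × ℤ => ((u.1 + n) / N, u.2)
    · intro u hu
      obtain ⟨-, h1, h2⟩ := hmem u hu
      simp only [Finset.coe_product, Finset.coe_Icc, Set.mem_prod, Set.mem_Icc]
      refine ⟨⟨Int.ediv_nonneg (by omega) (by omega), ?_⟩, h2⟩
      push_cast
      exact Int.ediv_le_ediv (by exact_mod_cast hNpos) (by omega)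
    · intro u hu w hw huw
      simp only [Prod.mk.injEq] at huw
      have hdvd : (N : ℤ) ∣ (u.1 + n) - (w.1 + n) := by
        have := dvd_sub (hmem u hu).1 (hmem w hw).1
        rwa [huw.2, add_sub_add_right_eq_sub, ← add_sub_add_right_eq_sub u.1 w.1 (n : ℤ)] at this
      have h3 : (u.1 + n) % N = (w.1 + n) % N := Int.emod_eq_emod_iff_emod_sub_eq_zero.2
        (Int.emod_eq_zero_of_dvd hdvd)
      have h4 := Int.emod_add_mul_ediv (u.1 + n) N
      have h5 := Int.emod_add_mul_ediv (w.1 + n) N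
      rw [h3, huw.1, h5] at h4
      ext
      · omega
      · exact huw.2
  rw [Finset.card_product, Int.card_Icc, Int.card_Icc] at h1
  have e1 : (((2 * n / N : ℕ) : ℤ) + 1 - 0).toNat = 2 * n / N + 1 := by
    generalize 2 * n / N = q
    omega
  have e2 : ((n : ℤ) + 1 - -n).toNat = 2 * n + 1 := by omega
  rw [e1, e2] at h1
  refine (Nat.mul_le_mul_left N h1).trans ?_
  rw [← mul_assoc]
  refine Nat.mul_le_mul_right _ ?_
  have := Nat.mul_div_le (2 * n) N
  rw [mul_add, mul_one]
  omega

theorem ncard_inter_box_le (T : Set (ℤ × ℤ)) (n : ℕ) : (T ∩ box n).ncard ≤ (2 * n + 1) ^ 2 := by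
  have h1 : (T ∩ box n).ncard ≤ (box n).ncard :=
    Set.ncard_le_ncard Set.inter_subset_right (by rw [← coe_boxFinset]; exact Finset.finite_toSet _)
  rw [← coe_boxFinset n, Set.ncard_coe_finset] at h1
  have h2 := card_boxFinset (n := n) (by positivity)
  rw [coe_boxFinset] at h1
  have h3 : (((T ∩ box n).ncard : ℕ) : ℤ) ≤ (2 * n + 1) ^ 2 := by
    rw [← h2]; exact_mod_cast h1
  exact_mod_cast h3

/-! ### Densities and the conclusion -/

theorem tendsto_inv_add_div (a C : ℝ) :
    Tendsto (fun n : ℕ => a + C / (2 * (n : ℝ) + 1)) atTop (nhds a) := by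
  have h : Tendsto (fun n : ℕ => 2 * (n : ℝ) + 1) atTop atTop :=
    tendsto_atTop_add_const_right _ _ (tendsto_natCast_atTop_atTop.const_mul_atTop (by norm_num))
  simpa using (h.const_div_atTop C).const_add a

theorem density_isBoundedUnder (T : Set (ℤ × ℤ)) :
    IsBoundedUnder (· ≤ ·) atTop
      fun n : ℕ => ((T ∩ box n).ncard : ℝ) / (2 * (n : ℝ) + 1) ^ 2 := by
  refine isBoundedUnder_of ⟨1, fun n => ?_⟩
  rw [div_le_one (by positivity)]
  exact_mod_cast ncard_inter_box_le T n

theorem density_isCoboundedUnder (T : Set (ℤ × ℤ)) :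
    IsCoboundedUnder (· ≤ ·) atTop
      fun n : ℕ => ((T ∩ box n).ncard : ℝ) / (2 * (n : ℝ) + 1) ^ 2 :=
  (isBoundedUnder_of ⟨0, fun n => by positivity⟩ :
    IsBoundedUnder (· ≥ ·) atTop _).isCoboundedUnder_le

theorem inv_le_density {T : Set (ℤ × ℤ)} {N C : ℝ} (hN : 0 < N)
    (h : ∀ᶠ n : ℕ in atTop, (2 * (n : ℝ) + 1) ^ 2 - C * (2 * n + 1) ≤ N * (T ∩ box n).ncard) :
    N⁻¹ ≤ density T := by
  rw [← (tendsto_inv_add_div N⁻¹ (-C / N)).limsup_eq, density]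
  refine limsup_le_limsup ?_ (tendsto_inv_add_div _ _).isCoboundedUnder_le
    (density_isBoundedUnder T)
  filter_upwards [h] with n hn
  have hpos : (0 : ℝ) < 2 * n + 1 := by positivity
  rw [le_div_iff₀ (by positivity), ← mul_le_mul_iff_right₀ hN]
  refine le_trans (le_of_eq ?_) hn
  field_simp
  ring

theorem density_le_inv {T : Set (ℤ × ℤ)} {N C : ℝ} (hN : 0 < N)
    (h : ∀ n : ℕ, N * (T ∩ box n).ncard ≤ (2 * (n : ℝ) + 1) ^ 2 + C * (2 * n + 1)) :
    density T ≤ N⁻¹ := by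
  rw [← (tendsto_inv_add_div N⁻¹ (C / N)).limsup_eq, density]
  refine limsup_le_limsup (Eventually.of_forall fun n => ?_) (density_isCoboundedUnder T)
    (tendsto_inv_add_div _ _).isBoundedUnder_le
  have hpos : (0 : ℝ) < 2 * n + 1 := by positivity
  rw [div_le_iff₀ (by positivity), ← mul_le_mul_iff_right₀ hN]
  refine (h n).trans (le_of_eq ?_)
  field_simp

theorem density_perfectTowers_le (R : ℕ) :
    density (perfectTowers R) ≤ (2 * (R : ℝ) ^ 2 + 2 * R + 1)⁻¹ := by
  apply density_le_inv (C := 2 * R ^ 2 + 2 * R) (by positivity)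
  intro n
  have h := ncard_perfectTowers_le R n
  have h' : (((2 * R ^ 2 + 2 * R + 1) * (perfectTowers R ∩ box n).ncard : ℕ) : ℝ) ≤
      (((2 * n + (2 * R ^ 2 + 2 * R + 1)) * (2 * n + 1) : ℕ) : ℝ) := by exact_mod_cast h
  push_cast at h'
  linarith

theorem inv_le_density_of_isDominating_one {R : ℕ} {T : Set (ℤ × ℤ)}
    (hT : IsDominating grid (R + 1) 1 T) : (2 * (R : ℝ) ^ 2 + 2 * R + 1)⁻¹ ≤ density T := by
  rw [isDominating_one_iff] at hT
  apply inv_le_density (C := 4 * R) (by positivity)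
  filter_upwards [eventually_ge_atTop R] with m hm
  obtain ⟨n, rfl⟩ := Nat.exists_eq_add_of_le' hm
  obtain ⟨F, hF, hcard⟩ := exists_finset_inter_box T (n + R)
  rw [hcard]
  have hsub : boxFinset n ⊆ F.biUnion fun P => (boxFinset n).filter fun v => l1 v P ≤ R := by
    intro v hv
    obtain ⟨u, hu, hd⟩ := hT v
    rw [l1_comm] at hd
    refine Finset.mem_biUnion.2 ⟨u, ?_, Finset.mem_filter.2 ⟨hv, hd⟩⟩
    rw [← Finset.mem_coe, hF]
    refine ⟨hu, ?_⟩
    rw [← coe_boxFinset, Finset.mem_coe, mem_boxFinset]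
    rw [mem_boxFinset] at hv
    simp only [l1] at hd
    have h1 := abs_le.1 (show |v.1 - u.1| ≤ R by linarith [abs_nonneg (v.2 - u.2)])
    have h2 := abs_le.1 (show |v.2 - u.2| ≤ R by linarith [abs_nonneg (v.1 - u.1)])
    push_cast
    omega
  have h1 := (Finset.card_le_card hsub).trans Finset.card_biUnion_le
  have h2 : ((2 * n + 1) ^ 2 : ℤ) ≤ F.card * (2 * R ^ 2 + 2 * R + 1) := by
    rw [← card_boxFinset (by positivity), ← nsmul_eq_mul, ← Finset.sum_const]
    refine (Nat.cast_le (α := ℤ).2 h1).trans ?_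
    rw [Nat.cast_sum]
    exact Finset.sum_le_sum fun P _ => card_le_of_l1_le (P := P) (by positivity)
      fun v hv => (Finset.mem_filter.1 hv).2
  have h3 : ((2 * n + 1) ^ 2 : ℝ) ≤ F.card * (2 * R ^ 2 + 2 * R + 1) := by exact_mod_cast h2
  push_cast
  nlinarith [(Nat.cast_nonneg R : (0 : ℝ) ≤ R)]

theorem inv_le_density_of_isDominating_three {R : ℕ} (hR : 16 ≤ R) {T : Set (ℤ × ℤ)}
    (hT : IsDominating grid (R + 2) 3 T) : (2 * (R : ℝ) ^ 2 + 2 * R + 1)⁻¹ ≤ density T := by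
  -- `C` generously absorbs the boundary strips between the boxes of radii k, k + R + 20 and k + 2R
  -- + 21. The outermost box contains every tower that reaches the middle one.
  apply inv_le_density (C := 20 * R + 200) (by positivity)
  filter_upwards [eventually_ge_atTop (2 * R + 21)] with m hm
  obtain ⟨k, rfl⟩ := Nat.exists_eq_add_of_le' hm
  obtain ⟨F, hF, hcard⟩ := exists_finset_inter_box T (k + (2 * R + 21))
  rw [hcard]
  have hmem : ∀ u : ℤ × ℤ, u ∈ F ↔ u ∈ T ∧ u ∈ boxFinset ((k + (2 * R + 21) : ℕ) : ℤ) := by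
    intro u
    rw [← Finset.mem_coe, hF, ← coe_boxFinset]
    rfl
  have h1 := card_towers_ge (R := R) (by omega) F (n := k + R + 20) (by positivity) (by
    intro v hv
    apply three_le_cappedSum hT (fun P hP => ((hmem P).1 hP).1)
    intro P hP hd
    refine (hmem P).2 ⟨hP, mem_boxFinset.2 ?_⟩
    rw [mem_boxFinset] at hv
    simp only [l1] at hd
    have h1 := abs_lt.1 (show |P.1 - v.1| < (R + 2 : ℕ) by linarith [abs_nonneg (P.2 - v.2)])
    have h2 := abs_lt.1 (show |P.2 - v.2| < (R + 2 : ℕ) by linarith [abs_nonneg (P.1 - v.1)])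
    push_cast at h1 h2 ⊢
    omega)
  rw [show ((k : ℤ) + R + 20 - (R + 20)) = k by ring] at h1
  have h2 : (F.card : ℤ) ≤ (F ∩ boxFinset k).card +
      ((2 * (k + (2 * R + 21)) + 1) ^ 2 - (2 * k + 1) ^ 2) := by
    have hsub : boxFinset (k : ℤ) ⊆ boxFinset ((k + (2 * R + 21) : ℕ) : ℤ) := by
      intro v hv
      rw [mem_boxFinset] at hv ⊢
      push_cast
      omega
    have h3 : F.card ≤ (F ∩ boxFinset k).card +
        (boxFinset ((k + (2 * R + 21) : ℕ) : ℤ) \ boxFinset k).card := by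
      rw [← Finset.card_inter_add_card_sdiff F (boxFinset k)]
      gcongr
      intro u hu
      exact ((hmem u).1 hu).2
    have h4 := Finset.card_sdiff_add_card_eq_card hsub
    have h5 := card_boxFinset (n := k) (by positivity)
    have h6 := card_boxFinset (n := ((k + (2 * R + 21) : ℕ) : ℤ)) (by positivity)
    rw [← h4] at h6
    push_cast at h6
    have h3' : (F.card : ℤ) ≤ (F ∩ boxFinset k).card +
        (boxFinset ((k + (2 * R + 21) : ℕ) : ℤ) \ boxFinset k).card := by exact_mod_cast h3
    push_cast at h3'
    linarith
  -- The 4 per tower of excess cancels the 4 in 3N + 4, except for towers in the boundary strip.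
  have h7 : 3 * (2 * ((k : ℤ) + R + 20) + 1) ^ 2 ≤ 3 * ((2 * R ^ 2 + 2 * R + 1) * F.card) +
      4 * ((2 * (k + (2 * R + 21)) + 1) ^ 2 - (2 * k + 1) ^ 2) := by linarith
  have h8 : 3 * (2 * ((k : ℝ) + R + 20) + 1) ^ 2 ≤ 3 * ((2 * R ^ 2 + 2 * R + 1) * F.card) +
      4 * ((2 * (k + (2 * R + 21)) + 1) ^ 2 - (2 * k + 1) ^ 2) := by exact_mod_cast h7
  push_cast
  nlinarith [(Nat.cast_nonneg R : (0 : ℝ) ≤ R), (Nat.cast_nonneg k : (0 : ℝ) ≤ k),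
    mul_nonneg (Nat.cast_nonneg R : (0 : ℝ) ≤ R) (Nat.cast_nonneg k : (0 : ℝ) ≤ k)]

theorem isLeast_densities_one (R : ℕ) :
    IsLeast (densities (R + 1) 1) (2 * (R : ℝ) ^ 2 + 2 * R + 1)⁻¹ := by
  refine ⟨⟨perfectTowers R, isDominating_perfectTowers R, le_antisymm (density_perfectTowers_le R)
    (inv_le_density_of_isDominating_one (isDominating_perfectTowers R))⟩, ?_⟩
  rintro _ ⟨T, hT, rfl⟩
  exact inv_le_density_of_isDominating_one hT

theorem isLeast_densities_three {R : ℕ} (hR : 16 ≤ R) :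
    IsLeast (densities (R + 2) 3) (2 * (R : ℝ) ^ 2 + 2 * R + 1)⁻¹ := by
  refine ⟨⟨perfectTowers R, isDominating_three_of_one (isDominating_perfectTowers R),
    le_antisymm (density_perfectTowers_le R)
      (inv_le_density_of_isDominating_one (isDominating_perfectTowers R))⟩, ?_⟩
  rintro _ ⟨T, hT, rfl⟩
  exact inv_le_density_of_isDominating_three hR hT

end Broadcast

end

/-- For `t > 17` the minimal density of a `(t, 3)` broadcast dominating set in the infinite grid
and that of a `(t - 1, 1)` broadcast dominating set are both attained, and they are equal. -/
theorem theorem1 (t : ℕ) (ht : 17 < t) :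
    IsLeast (Broadcast.densities t 3) (Broadcast.minDensity t 3) ∧
    IsLeast (Broadcast.densities (t - 1) 1) (Broadcast.minDensity (t - 1) 1) ∧
    Broadcast.minDensity t 3 = Broadcast.minDensity (t - 1) 1 := by
  obtain ⟨R, rfl⟩ := Nat.exists_eq_add_of_le' (show 2 ≤ t by omega)
  have h3 := Broadcast.isLeast_densities_three (show 16 ≤ R by omega)
  have h1 := Broadcast.isLeast_densities_one R
  rw [show R + 2 - 1 = R + 1 by omega, Broadcast.minDensity, Broadcast.minDensity, h3.csInf_eq,
    h1.csInf_eq]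
  exact ⟨h3, h1, rfl⟩
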